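/- A lattice polygon is the convex hull in $\mathbb{R}^2$ of a finite subset of $\mathbb{Z}^2$. A $\mathbb{Z}$-affine transformation is a map $\mathbb{R}^2\to\mathbb{R}^2$, $x\mapsto Ax+b$, with $A\in\mathrm{GL}_2(\mathbb{Z})$ and $b\in\mathbb{Z}^2$; write $\Delta\cong\Delta'$ if $\varphi(\Delta)=\Delta'$ for some $\mathbb{Z}$-affine transformation $\varphi$. The lattice width $\mathrm{lw}(\Delta)$ of a non-empty lattice polygon $\Delta$ is the smallest integer $s\ge 0$ such that $\varphi(\Delta)\subseteq\{(x,y)\in\mathbb{R}^2 : 0\le y\le s\}$ for some $\mathbb{Z}$-affine transformation $\varphi$; moreover $\mathrm{lw}(\emptyset)=-1$. Let $\Sigma=\mathrm{Conv}\{(0,0),(1,0),(0,1)\}$ be the standard $2$-simplex, and for an integer $d\ge 0$ let $d\Sigma$ be its Minkowski multiple. Let $\Delta$ be a two-dimensional lattice polygon, and let $\Delta^{(1)}$ be the (possibly empty) convex hull of the lattice points (points of $\mathbb{Z}^2$) in the topological interior of $\Delta$. Then \[ \mathrm{lw}(\Delta)=\mathrm{lw}(\Delta^{(1)})+2, \]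 unless $\Delta\cong d\Sigma$ for some integer $d\ge 2$, in which case \[ \mathrm{lw}(\Delta)=\mathrm{lw}(\Delta^{(1)})+3=d. \] -/

import Mathlib

open scoped Pointwise Matrix

namespace LatticePolygon

/-- The inclusion of `ℤ²` in `ℝ²`. -/
def ofInt (z : Fin 2 → ℤ) : Fin 2 → ℝ := fun i => (z i : ℝ)

/-- The set of lattice points, i.e. `ℤ²` inside `ℝ²`. -/
def latticePoints : Set (Fin 2 → ℝ) := Set.range ofInt

/-- A lattice polygon is the convex hull in `ℝ²` of a finite (possibly empty) subset of `ℤ²`. -/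
def IsLatticePolygon (Δ : Set (Fin 2 → ℝ)) : Prop :=
  ∃ S : Set (Fin 2 → ℝ), S.Finite ∧ S ⊆ latticePoints ∧ Δ = convexHull ℝ S

/-- The dimension of the smallest affine subspace containing `Δ`. -/
noncomputable def dim (Δ : Set (Fin 2 → ℝ)) : ℕ :=
  Module.finrank ℝ (affineSpan ℝ Δ).direction

/-- A `ℤ`-affine transformation `x ↦ A x + b` with `A ∈ GL₂(ℤ)` and `b ∈ ℤ²`. -/
def IsZAffine (φ : (Fin 2 → ℝ) → (Fin 2 → ℝ)) : Prop :=
  ∃ (A : GL (Fin 2) ℤ) (b : Fin 2 → ℤ),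
    ∀ x, φ x = ((A : Matrix (Fin 2) (Fin 2) ℤ).map (fun n : ℤ => (n : ℝ))) *ᵥ x + ofInt b

/-- Equivalence of polygons: some `ℤ`-affine transformation maps `Δ` onto `Δ'`. -/
def Equivalent (Δ Δ' : Set (Fin 2 → ℝ)) : Prop :=
  ∃ φ : (Fin 2 → ℝ) → (Fin 2 → ℝ), IsZAffine φ ∧ φ '' Δ = Δ'

/-- The horizontal strip `0 ≤ y ≤ s`. -/
def strip (s : ℕ) : Set (Fin 2 → ℝ) := {p | 0 ≤ p 1 ∧ p 1 ≤ (s : ℝ)}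

/-- The `s` such that some `ℤ`-affine transformation maps `Δ` into the strip of width `s`. -/
def stripWidths (Δ : Set (Fin 2 → ℝ)) : Set ℕ :=
  {s | ∃ φ : (Fin 2 → ℝ) → (Fin 2 → ℝ), IsZAffine φ ∧ φ '' Δ ⊆ strip s}

open Classical in
/-- The lattice width: the least element of `stripWidths Δ` when `Δ` is non-empty,
and `-1` when `Δ` is empty. -/
noncomputable def lw (Δ : Set (Fin 2 → ℝ)) : ℤ :=
  if Δ = ∅ then -1 else ((sInf (stripWidths Δ) : ℕ) : ℤ)

/-- `Δ^(1)`: the convex hull of the lattice points in the interior of `Δ`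
(the interior in `ℝ²` is empty when `Δ` is not two-dimensional). -/
def interiorHull (Δ : Set (Fin 2 → ℝ)) : Set (Fin 2 → ℝ) :=
  convexHull ℝ (interior Δ ∩ latticePoints)

/-- The standard 2-simplex in `ℝ²`, with vertices `(0,0)`, `(1,0)`, `(0,1)`. -/
def stdTriangle : Set (Fin 2 → ℝ) :=
  convexHull ℝ {![0, 0], ![1, 0], ![0, 1]}

/-- The infimum defining `lw` is a minimum for every bounded set, in particular for
every lattice polygon. -/
theorem stripWidths_nonempty {Δ : Set (Fin 2 → ℝ)} (h : Bornology.IsBounded Δ) :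
    (stripWidths Δ).Nonempty := by
  obtain ⟨R, hR⟩ := h.exists_norm_le
  obtain ⟨n, hn⟩ := exists_nat_ge R
  refine ⟨2 * n, fun x => x + ofInt (fun _ => (n : ℤ)), ⟨1, fun _ => (n : ℤ), fun x => ?_⟩, ?_⟩
  · simp [Matrix.map_one]
  · rintro _ ⟨x, hx, rfl⟩
    have h1 := (norm_le_pi_norm x 1).trans ((hR x hx).trans hn)
    rw [Real.norm_eq_abs, abs_le] at h1
    simp only [strip, ofInt, Set.mem_ofPred_eq, Pi.add_apply, Int.cast_natCast]
    push_cast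
    constructor <;> linarith [h1.1, h1.2]

theorem IsLatticePolygon.isBounded {Δ : Set (Fin 2 → ℝ)} (h : IsLatticePolygon Δ) :
    Bornology.IsBounded Δ := by
  obtain ⟨S, hS, -, rfl⟩ := h
  exact isBounded_convexHull.2 hS.isBounded

end LatticePolygon

/-! Let S be the set of lattice points of Δ. A nonzero integer functional takes strictly larger and
strictly smaller values on S than at any interior lattice point, so passing to the interior points
lowers each width by at least 2 (`Width.inner`). The substance is the converse: if s is the width of
the interior points, then S has width at most s + 2 or is a standard triangle of size s + 3.

The main tool is `exists_height_one`: a lattice triangle over a primitive side contains a lattice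
point at height one over that side. Hence no point of S lies more than one lattice step beyond an
edge of the interior polygon (`cross_le_add_one`).

Let f realise s ≥ 1. If S exceeds the interior points by at most one step on both sides, f has width
at most s + 2 on S. Otherwise f or -f has a single maximum P on the interior points. Minimality of
s, applied to the two edges at P, forces these to be unimodular of lattice length at least s, and S
lies in a unimodular triangle of size s + 3 (`width_or_triangle_of_height`). There S either contains
all three vertices or has width at most s + 2 (`width_or_triangle_of_subset`).

Three degenerate cases remain. If the interior points form a segment, both of its sides are edges.
If there is just one, the dual polygon supplies the functionals
(`width_or_triangle_of_unique_inner`). If there is none, either one edge gives width one, or two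
edges form a unimodular corner and the failure of nearby lattice points to be interior decides the
shape (`width_or_triangle_of_no_inner`).

Conversely, a triangle of size d has width exactly d, and its interior points have width at most d -
3. The real statement reduces to these integer ones because supporting lines may be taken rational
(`exists_int_support`). -/

namespace LatticePolygon

/-! ### Integer functionals and discrete convexity -/

/-- The determinant of two integer vectors; every integer linear functional on `ℤ²` has the form
`cross g`. -/
def cross (x y : ℤ × ℤ) : ℤ := x.1 * y.2 - x.2 * y.1

theorem cross_add_right (g x y : ℤ × ℤ) : cross g (x + y) = cross g x + cross g y := by
  simp only [cross, Prod.fst_add, Prod.snd_add]; ring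

theorem cross_sub_right (g x y : ℤ × ℤ) : cross g (x - y) = cross g x - cross g y := by
  simp only [cross, Prod.fst_sub, Prod.snd_sub]; ring

theorem cross_smul_right (n : ℤ) (g x : ℤ × ℤ) : cross g (n • x) = n * cross g x := by
  simp only [cross, Prod.smul_fst, Prod.smul_snd, smul_eq_mul]; ring

theorem cross_neg_right (g x : ℤ × ℤ) : cross g (-x) = -cross g x := by
  simp only [cross, Prod.fst_neg, Prod.snd_neg]; ring

theorem cross_add_left (g h x : ℤ × ℤ) : cross (g + h) x = cross g x + cross h x := by
  simp only [cross, Prod.fst_add, Prod.snd_add]; ring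

theorem cross_sub_left (g h x : ℤ × ℤ) : cross (g - h) x = cross g x - cross h x := by
  simp only [cross, Prod.fst_sub, Prod.snd_sub]; ring

theorem cross_smul_left (n : ℤ) (g x : ℤ × ℤ) : cross (n • g) x = n * cross g x := by
  simp only [cross, Prod.smul_fst, Prod.smul_snd, smul_eq_mul]; ring

theorem cross_neg_left (g x : ℤ × ℤ) : cross (-g) x = -cross g x := by
  simp only [cross, Prod.fst_neg, Prod.snd_neg]; ring

theorem cross_self (x : ℤ × ℤ) : cross x x = 0 := by simp only [cross]; ring

theorem cross_swap (x y : ℤ × ℤ) : cross y x = -cross x y := by simp only [cross]; ring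

/-- Cramer's rule in dimension two. -/
theorem cross_mul_cross (g x u v : ℤ × ℤ) :
    cross u v * cross g x = cross g u * cross x v + cross g v * cross u x := by
  simp only [cross]; ring

theorem ne_zero_of_cross_ne_zero {f x : ℤ × ℤ} (h : cross f x ≠ 0) : f ≠ 0 := by
  rintro rfl; simp [cross] at h

theorem ne_zero_of_isCoprime {u : ℤ × ℤ} (h : IsCoprime u.1 u.2) : u ≠ 0 := by
  rintro rfl; simp [isCoprime_zero_left] at h

/-- The lattice point `z` lies on no supporting line of `S`. -/
def Inner (S : Set (ℤ × ℤ)) (z : ℤ × ℤ) : Prop :=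
  ∀ f : ℤ × ℤ, f ≠ 0 → ∃ x ∈ S, cross f z < cross f x

/-- Some nonzero functional takes values on `S` that differ by at most `n`. -/
def Width (S : Set (ℤ × ℤ)) (n : ℤ) : Prop :=
  ∃ f : ℤ × ℤ, f ≠ 0 ∧ ∀ x ∈ S, ∀ y ∈ S, cross f x - cross f y ≤ n

/-- In suitable unimodular coordinates, `S` lies in the triangle with vertices
`(0, 0)`, `(d, 0)`, `(0, d)` and contains these vertices. -/
def Triangle (S : Set (ℤ × ℤ)) (d : ℤ) : Prop :=
  ∃ (a b : ℤ × ℤ) (c e : ℤ), (cross a b = 1 ∨ cross a b = -1) ∧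
    (∀ x ∈ S, 0 ≤ cross a x + c ∧ 0 ≤ cross b x + e ∧ cross a x + c + (cross b x + e) ≤ d) ∧
    (∃ x ∈ S, cross a x + c = 0 ∧ cross b x + e = 0) ∧
    (∃ x ∈ S, cross a x + c = d ∧ cross b x + e = 0) ∧
    (∃ x ∈ S, cross a x + c = 0 ∧ cross b x + e = d)

/-- A set of lattice points containing the first lattice point on the segment between
any two of its points. -/
def SegmentClosed (S : Set (ℤ × ℤ)) : Prop :=
  ∀ (x u : ℤ × ℤ) (n : ℤ), 1 ≤ n → x ∈ S → x + n • u ∈ S → x + u ∈ S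

/-! ### Primitive vectors and lattice points at height one -/

theorem exists_eq_smul_isCoprime {f : ℤ × ℤ} (hf : f ≠ 0) :
    ∃ (n : ℤ) (u : ℤ × ℤ), 1 ≤ n ∧ IsCoprime u.1 u.2 ∧ f = n • u := by
  have hg : 0 < Int.gcd f.1 f.2 := by
    rw [Int.gcd_pos_iff]
    by_contra! h
    exact hf (Prod.ext h.1 h.2)
  refine ⟨Int.gcd f.1 f.2, (f.1 / Int.gcd f.1 f.2, f.2 / Int.gcd f.1 f.2), by exact_mod_cast hg,
    ?_, ?_⟩
  · rw [Int.isCoprime_iff_gcd_eq_one]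
    exact Int.gcd_ediv_gcd_ediv_gcd hg
  · refine Prod.ext ?_ ?_
    · exact (Int.mul_ediv_cancel' (Int.gcd_dvd_left _ _)).symm
    · exact (Int.mul_ediv_cancel' (Int.gcd_dvd_right _ _)).symm

theorem exists_cross_eq_one {u : ℤ × ℤ} (hu : IsCoprime u.1 u.2) : ∃ w, cross u w = 1 := by
  obtain ⟨a, b, h⟩ := hu
  exact ⟨(-b, a), by simp only [cross]; linarith⟩

theorem eq_smul_add_smul {u w : ℤ × ℤ} (h : cross u w = 1) (x : ℤ × ℤ) :
    x = cross x w • u + cross u x • w := by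
  simp only [cross] at h
  refine Prod.ext ?_ ?_ <;>
    simp only [cross, Prod.fst_add, Prod.snd_add, Prod.smul_fst, Prod.smul_snd, smul_eq_mul]
  · linear_combination (-x.1) * h
  · linear_combination (-x.2) * h

/-- If `u` is primitive, the triangle `p`, `p + u`, `r` contains a lattice point at
height one over the side `p`, `p + u`. -/
theorem exists_height_one {u : ℤ × ℤ} (hu : IsCoprime u.1 u.2) (p r : ℤ × ℤ) {h : ℤ}
    (hh : cross u (r - p) = h) (hpos : 0 < h) :
    ∃ (m : ℤ × ℤ) (t : ℤ), 0 ≤ t ∧ t ≤ h - 1 ∧ h • m = r + (h - 1 - t) • p + t • (p + u) ∧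
      cross u (m - p) = 1 := by
  obtain ⟨w, hw⟩ := exists_cross_eq_one hu
  have hr := eq_smul_add_smul hw (r - p)
  rw [hh] at hr
  set A := cross (r - p) w
  -- In the basis `u`, `w` the point sought is `p + ((A + t) / h) • u + w`. Exactly one `t` among
  -- `0, …, h - 1` makes the coefficient integral, namely the residue of `-A`.
  have h1 := Int.mul_ediv_add_emod (-A) h
  have h2 := Int.emod_nonneg (-A) hpos.ne'
  have h3 := Int.emod_lt_of_pos (-A) hpos
  refine ⟨p + (-((-A) / h)) • u + w, (-A) % h, h2, by omega, ?_, ?_⟩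
  · have : r = p + (A • u + h • w) := by rw [← hr]; abel
    rw [this]
    set t := (-A) % h
    set q := (-A) / h
    refine Prod.ext ?_ ?_ <;>
      simp only [Prod.fst_add, Prod.snd_add, Prod.smul_fst, Prod.smul_snd, smul_eq_mul]
    · linear_combination (-u.1) * h1
    · linear_combination (-u.2) * h1
  · simp only [cross_sub_right, cross_add_right, cross_smul_right, cross_self, hw]
    ring

theorem Inner.exists_lt {S : Set (ℤ × ℤ)} {z : ℤ × ℤ} (hz : Inner S z) {f : ℤ × ℤ} (hf : f ≠ 0) :
    ∃ x ∈ S, cross f x < cross f z := by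
  obtain ⟨x, hx, h⟩ := hz (-f) (neg_ne_zero.2 hf)
  simp only [cross_neg_left] at h
  exact ⟨x, hx, by linarith⟩

/-- A functional is monotone along a segment, so a witness for one of the two ends also serves for
the point between. -/
theorem segmentClosed_inner (S : Set (ℤ × ℤ)) : SegmentClosed {z | Inner S z} := by
  intro x u n hn hx hy f hf
  obtain ⟨a, ha, ha'⟩ := hx f hf
  obtain ⟨b, hb, hb'⟩ := hy f hf
  simp only [cross_add_right, cross_smul_right] at hb' ⊢
  rcases le_total (cross f u) 0 with h | h
  · exact ⟨a, ha, by linarith⟩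
  · exact ⟨b, hb, by nlinarith⟩

/-- Lattice points of a polygon lie at height at most one over any edge of the interior polygon. -/
theorem cross_le_add_one {S : Set (ℤ × ℤ)} {p u : ℤ × ℤ} (hu : IsCoprime u.1 u.2)
    (hp : Inner S p) (hq : Inner S (p + u)) (hmax : ∀ z, Inner S z → cross u z ≤ cross u p)
    {r : ℤ × ℤ} (hr : r ∈ S) : cross u r ≤ cross u p + 1 := by
  by_contra! hcon
  obtain ⟨m, t, ht0, ht1, hm, hm1⟩ := exists_height_one hu p r rfl
    (by rw [cross_sub_right]; linarith)
  have hh : 2 ≤ cross u (r - p) := by rw [cross_sub_right]; linarith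
  generalize cross u (r - p) = h at *
  suffices Inner S m by
    have := hmax m this
    rw [cross_sub_right] at hm1
    linarith
  -- `m` is a convex combination of `r` with weight `1 / h < 1` and of inner points. If `f` were at
  -- most `f m` on `S`, it would be smaller by at least one at `p` and `p + u`, contradicting the
  -- average.
  intro f hf
  have key := congrArg (cross f) hm
  obtain ⟨x, hx, hx'⟩ := hp f hf
  obtain ⟨y, hy, hy'⟩ := hq f hf
  simp only [cross_add_right, cross_smul_right] at key hy'
  by_contra! hno
  have := hno x hx
  have := hno y hy
  have := hno r hr
  nlinarith [mul_nonneg ht0 (show 0 ≤ cross f m - (cross f p + cross f u) - 1 by linarith),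
    mul_nonneg (show 0 ≤ h - 1 - t by linarith) (show 0 ≤ cross f m - cross f p - 1 by linarith)]

/-- A polygon whose only interior lattice point is `P` has lattice distance one between `P` and
each edge. -/
theorem cross_eq_one_of_unique {S : Set (ℤ × ℤ)} {P p u : ℤ × ℤ} (hu : IsCoprime u.1 u.2)
    (hp : p ∈ S) (hq : p + u ∈ S) (hP : Inner S P) (huniq : ∀ z, Inner S z → z = P)
    (hpos : ∀ x ∈ S, 0 ≤ cross u (x - p)) : cross u (P - p) = 1 := by
  obtain ⟨x, hx, hx'⟩ := hP.exists_lt (ne_zero_of_isCoprime hu)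
  have h0 := hpos x hx
  obtain ⟨m, t, ht0, ht1, hm, hm1⟩ := exists_height_one hu p P rfl
    (by rw [cross_sub_right] at h0 ⊢; linarith)
  have : m = P := by
    -- `P` enters the convex combination with positive weight `1 / h`, so `m` is interior like `P`.
    refine huniq m fun f hf => ?_
    have key := congrArg (cross f) hm
    obtain ⟨y, hy, hy'⟩ := hP f hf
    simp only [cross_add_right, cross_smul_right] at key
    by_contra! hno
    have := hno y hy
    have := hno p hp
    have h5 := hno _ hq
    rw [cross_add_right] at h5
    nlinarith [mul_nonneg ht0 (show 0 ≤ cross f m - (cross f p + cross f u) by linarith),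
      mul_nonneg (show 0 ≤ cross u (P - p) - 1 - t by linarith)
        (show 0 ≤ cross f m - cross f p by linarith)]
  rwa [this] at hm1

/-! ### Edges and vertices -/

/-- Where `cross h` is negative, this turns a comparison of slopes relative to `h` into the sign of
`cross x y`. -/
theorem sq_add_sq_mul_cross {h x y : ℤ × ℤ} :
    (h.1 ^ 2 + h.2 ^ 2) * cross x y =
      cross h x * (h.1 * y.1 + h.2 * y.2) * (-1) + (h.1 * x.1 + h.2 * x.2) * cross h y := by
  simp only [cross]; ring

/-- The two edges at a vertex that is the only maximum of a functional. -/
theorem exists_edges {T : Set (ℤ × ℤ)} (hfin : T.Finite) (hseg : SegmentClosed T)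
    {Q h : ℤ × ℤ} (hQ : Q ∈ T) (hmax : ∀ x ∈ T, x ≠ Q → cross h x < cross h Q)
    (hdim : ∀ f : ℤ × ℤ, f ≠ 0 → ∃ x ∈ T, cross f x ≠ cross f Q) :
    ∃ u v : ℤ × ℤ, IsCoprime u.1 u.2 ∧ IsCoprime v.1 v.2 ∧ Q + u ∈ T ∧ Q + v ∈ T ∧
      0 < cross u v ∧ ∀ x ∈ T, 0 ≤ cross u (x - Q) ∧ 0 ≤ cross (x - Q) v := by
  have hT : (T \ {Q}).Nonempty := by
    obtain ⟨x, hx, hx'⟩ := hdim (1, 0) (by simp)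
    exact ⟨x, hx, by rintro rfl; exact hx' rfl⟩
  have hfin' : (T \ {Q}).Finite := hfin.subset Set.sdiff_subset
  -- The slope of `x` seen from `Q`, relative to `h`; the denominator is positive because `Q` is the
  -- only maximum. The points of extreme slope lie on the two edges at `Q`.
  let s : ℤ × ℤ → ℚ := fun x =>
    ((h.1 * (x - Q).1 + h.2 * (x - Q).2 : ℤ) : ℚ) / ((-cross h (x - Q) : ℤ) : ℚ)
  have hneg : ∀ x ∈ T \ {Q}, 0 < -cross h (x - Q) := by
    intro x hx
    have := hmax x hx.1 hx.2
    rw [cross_sub_right]; linarith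
  have hh : 0 < h.1 ^ 2 + h.2 ^ 2 := by
    obtain ⟨x, hx⟩ := hT
    have hx := hneg x hx
    have : h.1 ≠ 0 ∨ h.2 ≠ 0 := by
      by_contra! hc
      simp [cross, hc.1, hc.2] at hx
    rcases this with h' | h' <;> positivity
  have hs : ∀ x ∈ T \ {Q}, ∀ y ∈ T \ {Q}, s x ≤ s y → 0 ≤ cross (x - Q) (y - Q) := by
    intro x hx y hy hxy
    rw [div_le_div_iff₀ (by exact_mod_cast hneg x hx) (by exact_mod_cast hneg y hy)] at hxy
    have hxy' : (h.1 * (x - Q).1 + h.2 * (x - Q).2) * (-cross h (y - Q)) ≤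
      (h.1 * (y - Q).1 + h.2 * (y - Q).2) * (-cross h (x - Q)) := by exact_mod_cast hxy
    have := sq_add_sq_mul_cross (h := h) (x := x - Q) (y := y - Q)
    have : 0 ≤ (h.1 ^ 2 + h.2 ^ 2) * cross (x - Q) (y - Q) := by linarith
    exact nonneg_of_mul_nonneg_right this hh
  obtain ⟨y, hy, hymin⟩ := Set.exists_min_image _ s hfin' hT
  obtain ⟨z, hz, hzmax⟩ := Set.exists_max_image _ s hfin' hT
  obtain ⟨n, u, hn, hu, hnu⟩ := exists_eq_smul_isCoprime (sub_ne_zero.2 hy.2)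
  obtain ⟨k, v, hk, hv, hkv⟩ := exists_eq_smul_isCoprime (sub_ne_zero.2 hz.2)
  have hcu : ∀ x ∈ T, 0 ≤ cross u (x - Q) := by
    intro x hx
    rcases eq_or_ne x Q with rfl | hxQ
    · simp [cross]
    have := hs y hy x ⟨hx, hxQ⟩ (hymin x ⟨hx, hxQ⟩)
    rw [hnu, cross_smul_left] at this
    exact nonneg_of_mul_nonneg_right this (by linarith)
  have hcv : ∀ x ∈ T, 0 ≤ cross (x - Q) v := by
    intro x hx
    rcases eq_or_ne x Q with rfl | hxQ
    · simp [cross]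
    have := hs x ⟨hx, hxQ⟩ z hz (hzmax x ⟨hx, hxQ⟩)
    rw [hkv, cross_smul_right] at this
    exact nonneg_of_mul_nonneg_right this (by linarith)
  have hhu : cross h u < 0 := by
    have := hneg y hy
    rw [hnu, cross_smul_right] at this
    nlinarith
  have hhv : cross h v < 0 := by
    have := hneg z hz
    rw [hkv, cross_smul_right] at this
    nlinarith
  have hQu : Q + u ∈ T := hseg Q u n hn hQ (by rw [← hnu]; simpa using hy.1)
  have hQv : Q + v ∈ T := hseg Q v k hk hQ (by rw [← hkv]; simpa using hz.1)
  refine ⟨u, v, hu, hv, hQu, hQv, ?_, fun x hx => ⟨hcu x hx, hcv x hx⟩⟩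
  have h0 : 0 ≤ cross u v := by simpa using hcu _ hQv
  refine lt_of_le_of_ne h0 fun h0 => ?_
  obtain ⟨x, hx, hx'⟩ := hdim u (ne_zero_of_isCoprime hu)
  have h1 := cross_mul_cross h (x - Q) u v
  have h2 := hcu x hx
  have h3 := hcv x hx
  have h4 : cross u (x - Q) ≠ 0 := by rw [cross_sub_right]; exact sub_ne_zero.2 hx'
  have h5 : 0 < cross u (x - Q) := lt_of_le_of_ne h2 h4.symm
  rw [← h0] at h1
  nlinarith

theorem eq_or_eq_neg_of_cross_eq_zero {u v : ℤ × ℤ} (hu : IsCoprime u.1 u.2)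
    (hv : IsCoprime v.1 v.2) (h : cross u v = 0) : v = u ∨ v = -u := by
  obtain ⟨w, hw⟩ := exists_cross_eq_one hu
  have h1 := eq_smul_add_smul hw v
  rw [h, zero_smul, add_zero] at h1
  generalize cross v w = c at h1
  have hc : IsUnit c := by
    refine hv.isUnit_of_dvd' ?_ ?_ <;> rw [h1] <;> simp
  rcases Int.isUnit_iff.1 hc with rfl | rfl
  · left; simpa using h1
  · right; simpa using h1

/-- A linear functional attains its maximum along an edge or at a single point. -/
theorem exists_edge_or_vertex {T : Set (ℤ × ℤ)} (hfin : T.Finite) (hne : T.Nonempty)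
    (hseg : SegmentClosed T) {h : ℤ × ℤ} (hh : h ≠ 0) :
    (∃ (p u : ℤ × ℤ) (n : ℤ), 1 ≤ n ∧ h = n • u ∧ IsCoprime u.1 u.2 ∧ p ∈ T ∧ p + u ∈ T ∧
      ∀ x ∈ T, cross u x ≤ cross u p) ∨
    ∃ Q ∈ T, ∀ x ∈ T, x ≠ Q → cross h x < cross h Q := by
  obtain ⟨Q, hQ, hQmax⟩ := Set.exists_max_image T (cross h) hfin hne
  by_cases H : ∀ x ∈ T, x ≠ Q → cross h x < cross h Q
  · exact Or.inr ⟨Q, hQ, H⟩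
  left
  push Not at H
  obtain ⟨y, hy, hyQ, hle⟩ := H
  obtain ⟨k, v, hk, hv, hkv⟩ := exists_eq_smul_isCoprime (sub_ne_zero.2 hyQ)
  obtain ⟨n, u, hn, hu, rfl⟩ := exists_eq_smul_isCoprime hh
  have hQv : Q + v ∈ T := hseg Q v k hk hQ (by rw [← hkv]; simpa using hy)
  have heq := le_antisymm hle (hQmax y hy)
  have h0 : cross u v = 0 := by
    have : n * (k * cross u v) = 0 := by
      rw [← cross_smul_right, ← hkv, cross_sub_right, mul_sub, ← cross_smul_left,
        ← cross_smul_left, heq, sub_self]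
    have hn' : n ≠ 0 := by omega
    have hk' : k ≠ 0 := by omega
    simpa [hn', hk'] using this
  have hmax : ∀ x ∈ T, cross u x ≤ cross u Q := by
    intro x hx
    have := hQmax x hx
    rw [cross_smul_left, cross_smul_left] at this
    exact le_of_mul_le_mul_left this (by omega)
  rcases eq_or_eq_neg_of_cross_eq_zero hu hv h0 with rfl | rfl
  · exact ⟨Q, v, n, hn, rfl, hu, hQ, hQv, hmax⟩
  · refine ⟨Q + -u, u, n, hn, rfl, hu, hQv, by simpa using hQ, ?_⟩
    simpa [cross_add_right, cross_neg_right, cross_self] using hmax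

/-! ### Width and unimodular triangles -/

theorem Width.mono {S : Set (ℤ × ℤ)} {m n : ℤ} (h : Width S m) (hmn : m ≤ n) : Width S n := by
  obtain ⟨f, hf, h⟩ := h
  exact ⟨f, hf, fun x hx y hy => (h x hx y hy).trans hmn⟩

theorem exists_lt_of_not_width {S : Set (ℤ × ℤ)} {n : ℤ} (h : ¬ Width S n) {f : ℤ × ℤ}
    (hf : f ≠ 0) : ∃ x ∈ S, ∃ y ∈ S, n < cross f x - cross f y := by
  by_contra! hc
  exact h ⟨f, hf, hc⟩

theorem exists_cross_ne {S : Set (ℤ × ℤ)} (h : ¬ Width S 0) (Q : ℤ × ℤ) {f : ℤ × ℤ}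
    (hf : f ≠ 0) : ∃ x ∈ S, cross f x ≠ cross f Q := by
  obtain ⟨x, hx, y, hy, hxy⟩ := exists_lt_of_not_width h hf
  by_contra! hc
  rw [hc x hx, hc y hy] at hxy
  simp at hxy

theorem nonempty_of_not_width {S : Set (ℤ × ℤ)} {n : ℤ} (h : ¬ Width S n) : S.Nonempty := by
  obtain ⟨x, hx, -⟩ := exists_lt_of_not_width h (f := (1, 0)) (by simp)
  exact ⟨x, hx⟩

/-- A polygon inside a unimodular triangle of size `s + 3` has width at most `s + 2` unless it
contains the three vertices. -/
theorem width_or_triangle_of_subset {S : Set (ℤ × ℤ)} {P a b : ℤ × ℤ} {s : ℤ}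
    (hdet : cross a b = 1 ∨ cross a b = -1) (ha : ∀ x ∈ S, cross a (x - P) ≤ 1)
    (hb : ∀ x ∈ S, cross b (x - P) ≤ 1)
    (hab : ∀ x ∈ S, -(s + 1) ≤ cross a (x - P) + cross b (x - P)) :
    Width S (s + 2) ∨ Triangle S (s + 3) := by
  have hab0 : cross a b ≠ 0 := by rcases hdet with h | h <;> rw [h] <;> norm_num
  -- On the triangle each of `a`, `b`, `a + b` varies by `s + 3`. One that misses its extreme value
  -- at a vertex has width at most `s + 2`; if none does, the three vertices belong to `S`.
  by_cases h1 : ∃ x ∈ S, cross a (x - P) ≤ -(s + 2)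
  · by_cases h2 : ∃ x ∈ S, cross b (x - P) ≤ -(s + 2)
    · by_cases h3 : ∃ x ∈ S, 2 ≤ cross a (x - P) + cross b (x - P)
      · right
        obtain ⟨x, hx, hx'⟩ := h1
        obtain ⟨y, hy, hy'⟩ := h2
        obtain ⟨z, hz, hz'⟩ := h3
        simp only [cross_sub_right] at *
        refine ⟨-a, -b, 1 + cross a P, 1 + cross b P, ?_, ?_, ⟨z, hz, ?_⟩, ⟨x, hx, ?_⟩,
          ⟨y, hy, ?_⟩⟩
        · simpa [cross_neg_left, cross_neg_right] using hdet
        · intro t ht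
          have := ha t ht
          have := hb t ht
          have := hab t ht
          simp only [cross_neg_left]
          refine ⟨?_, ?_, ?_⟩ <;> linarith
        · have := ha z hz
          have := hb z hz
          simp only [cross_neg_left]
          constructor <;> linarith
        · have := hb x hx
          have := hab x hx
          simp only [cross_neg_left]
          constructor <;> linarith
        · have := ha y hy
          have := hab y hy
          simp only [cross_neg_left]
          constructor <;> linarith
      · left
        refine ⟨a + b, ?_, fun x hx y hy => ?_⟩
        · apply ne_zero_of_cross_ne_zero (x := b)
          rwa [cross_add_left, cross_self, add_zero]
        · push Not at h3
          have := h3 x hx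
          have := hab y hy
          simp only [cross_sub_right, cross_add_left] at *
          linarith
    · left
      refine ⟨b, ?_, fun x hx y hy => ?_⟩
      · apply ne_zero_of_cross_ne_zero (x := a)
        rwa [cross_swap, neg_ne_zero]
      · push Not at h2
        have := h2 y hy
        have := hb x hx
        simp only [cross_sub_right] at *
        linarith
  · left
    refine ⟨a, ne_zero_of_cross_ne_zero hab0, fun x hx y hy => ?_⟩
    push Not at h1
    have := h1 y hy
    have := ha x hx
    simp only [cross_sub_right] at *
    linarith

/-! ### One interior lattice point -/

/-- A cone spanned by two elements of a lattice-convex set containing `0` can be shrunk to a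
unimodular cone around a given vector. -/
theorem exists_unimodular_cone {V : Set (ℤ × ℤ)}
    (hV : ∀ a ∈ V, ∀ b ∈ V, ∀ (m : ℤ × ℤ) (D i j : ℤ), 0 < D → 0 ≤ i → 0 ≤ j → i + j ≤ D →
      D • m = i • a + j • b → m ∈ V) (T : ℤ × ℤ) :
    ∀ (n : ℕ), ∀ a ∈ V, ∀ b ∈ V, 0 < cross a b → cross a b ≤ n → 0 ≤ cross a T →
      0 ≤ cross T b →
      ∃ a ∈ V, ∃ b ∈ V, cross a b = 1 ∧ 0 ≤ cross a T ∧ 0 ≤ cross T b := by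
  intro n
  induction n with
  | zero => intro a _ b _ h1 h2; simp at h2; omega
  | succ n ih =>
    intro a ha b hb hpos hn haT hTb
    rcases eq_or_lt_of_le (show 1 ≤ cross a b from hpos) with h1 | h1
    · exact ⟨a, ha, b, hb, h1.symm, haT, hTb⟩
    obtain ⟨m, i, j, hi0, hi1, hj0, hj1, hij0, hij1, hm⟩ : ∃ (m : ℤ × ℤ) (i j : ℤ),
        0 ≤ i ∧ i < cross a b ∧ 0 ≤ j ∧ j < cross a b ∧ 0 < i + j ∧ i + j ≤ cross a b ∧
        cross a b • m = i • a + j • b := by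
      -- Otherwise `a` and `b` would span the whole lattice, and `cross a b` would divide 1.
      obtain ⟨x, hx⟩ : ∃ x : ℤ × ℤ, cross x b % cross a b ≠ 0 ∨ cross a x % cross a b ≠ 0 := by
        by_contra! hc
        obtain ⟨k1, e1⟩ := Int.dvd_of_emod_eq_zero (hc (1, 0)).1
        obtain ⟨k2, e2⟩ := Int.dvd_of_emod_eq_zero (hc (1, 0)).2
        obtain ⟨k3, e3⟩ := Int.dvd_of_emod_eq_zero (hc (0, 1)).1
        obtain ⟨k4, e4⟩ := Int.dvd_of_emod_eq_zero (hc (0, 1)).2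
        have hD : cross a b * 1 = cross a b * (cross a b * (k1 * k4 - k2 * k3)) := by
          have : cross a b = cross (1, 0) b * cross a (0, 1) - cross a (1, 0) * cross (0, 1) b := by
            simp only [cross]; ring
          rw [e1, e2, e3, e4] at this
          linarith
        have hD' := mul_left_cancel₀ hpos.ne' hD
        have := Int.le_of_dvd one_pos (Dvd.intro _ hD'.symm)
        omega
      have hi1 := Int.emod_lt_of_pos (cross x b) hpos
      have hj1 := Int.emod_lt_of_pos (cross a x) hpos
      have hi0 := Int.emod_nonneg (cross x b) hpos.ne'
      have hj0 := Int.emod_nonneg (cross a x) hpos.ne'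
      have hi := Int.mul_ediv_add_emod (cross x b) (cross a b)
      have hj := Int.mul_ediv_add_emod (cross a x) (cross a b)
      have hm : cross a b • (x - (cross x b / cross a b) • a - (cross a x / cross a b) • b) =
          (cross x b % cross a b) • a + (cross a x % cross a b) • b := by
        have key : cross a b • x = cross x b • a + cross a x • b := by
          refine Prod.ext ?_ ?_ <;>
            simp only [cross, Prod.fst_add, Prod.snd_add, Prod.smul_fst, Prod.smul_snd,
              smul_eq_mul] <;> ring
        rw [smul_sub, smul_sub, key, smul_smul, smul_smul, eq_sub_of_add_eq' hi,
          eq_sub_of_add_eq' hj]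
        module
      set i := cross x b % cross a b
      set j := cross a x % cross a b
      rcases le_or_gt (i + j) (cross a b) with h | h
      · exact ⟨_, i, j, hi0, hi1, hj0, hj1, by omega, h, hm⟩
      -- The reduced point lies in the far half of the parallelogram; reflection in its centre
      -- brings it into the triangle `0`, `a`, `b`.
      · refine ⟨a + b - (x - (cross x b / cross a b) • a - (cross a x / cross a b) • b),
          cross a b - i, cross a b - j, by omega, by omega, by omega, by omega, by omega,
          by omega, ?_⟩
        rw [smul_sub, hm]
        module
    have hmV := hV a ha b hb m _ i j hpos hi0 hj0 hij1 hm
    have ham : cross a m = j := by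
      have := congrArg (cross a) hm
      simp only [cross_add_right, cross_smul_right, cross_self] at this
      exact mul_left_cancel₀ hpos.ne' (by linarith)
    have hmb : cross m b = i := by
      have := congrArg (cross b) hm
      simp only [cross_add_right, cross_smul_right, cross_self, cross_swap a b,
        cross_swap m b] at this
      exact mul_left_cancel₀ hpos.ne' (by linarith)
    have hmT : cross a b * cross m T = i * cross a T - j * cross T b := by
      rw [← cross_smul_left, hm, cross_add_left, cross_smul_left, cross_smul_left, cross_swap T b]
      ring
    have hTm := cross_swap m T
    -- The vector `m` cuts the cone into pieces of determinants `i` and `j`, both smaller than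
    -- before; the induction continues in a nondegenerate piece containing `T`.
    by_cases hb' : 0 ≤ cross m T ∧ 0 < i
    · exact ih m hmV b hb (by omega) (by push_cast at hn; omega) hb'.1 hTb
    · have h0 : cross m T ≤ 0 := by
        by_contra! hc
        have : i = 0 := by
          by_contra hi
          exact hb' ⟨hc.le, by omega⟩
        rw [this] at hmT
        nlinarith
      have hj : 0 < j := by
        by_contra! hj
        have hj : j = 0 := by omega
        rw [hj] at hmT
        have hi : 0 < i := by omega
        refine hb' ⟨?_, hi⟩
        have : 0 ≤ cross a b * cross m T := by rw [hmT]; nlinarith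
        exact nonneg_of_mul_nonneg_right this hpos
      exact ih a ha m hmV (by omega) (by push_cast at hn; omega) haT (by omega)

/-- The case of a polygon with exactly one interior lattice point. -/
theorem width_or_triangle_of_unique_inner {S : Set (ℤ × ℤ)} (hfin : S.Finite)
    (hseg : SegmentClosed S) (hS : ¬ Width S 0) {P : ℤ × ℤ} (hP : Inner S P)
    (huniq : ∀ z, Inner S z → z = P) : Width S 2 ∨ Triangle S 3 := by
  have hne := nonempty_of_not_width hS
  -- The lattice points of the polygon dual to `S` about `P`. Primitive outer normals of edges
  -- belong to it, as every edge has lattice distance one from `P`.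
  let V : Set (ℤ × ℤ) := {v | ∀ x ∈ S, cross v (x - P) ≤ 1}
  have hedge : ∀ p u : ℤ × ℤ, IsCoprime u.1 u.2 → p ∈ S → p + u ∈ S →
      (∀ x ∈ S, cross u x ≤ cross u p) → u ∈ V := by
    intro p u hu hp hq hmax x hx
    have h1 := cross_eq_one_of_unique (u := -u) (p := p + u)
      (by simpa only [Prod.fst_neg, Prod.snd_neg] using hu.neg_neg) hq (by simpa using hp) hP huniq
      (by
        intro x hx
        have := hmax x hx
        simp only [cross_sub_right, cross_add_right, cross_neg_left, cross_self]
        linarith)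
    have := hmax x hx
    simp only [cross_sub_right, cross_add_right, cross_neg_left, cross_self] at h1 ⊢
    linarith
  have hcone : ∀ h Q : ℤ × ℤ, Q ∈ S → (∀ x ∈ S, x ≠ Q → cross h x < cross h Q) →
      ∃ a ∈ V, ∃ b ∈ V, 0 < cross a b ∧ 0 ≤ cross a h ∧ 0 ≤ cross h b ∧ a ≠ 0 := by
    intro h Q hQ hmax
    obtain ⟨u, v, hu, hv, hQu, hQv, huv, hcr⟩ := exists_edges hfin hseg hQ hmax
      fun f hf => exists_cross_ne hS Q hf
    have hle : ∀ x ∈ S, cross h x ≤ cross h Q := by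
      intro x hx
      rcases eq_or_ne x Q with rfl | hxQ
      · rfl
      · exact (hmax x hx hxQ).le
    have h1 := hle _ hQu
    have h2 := hle _ hQv
    rw [cross_add_right] at h1 h2
    refine ⟨v, hedge Q v hv hQ hQv ?_, -u, hedge (Q + u) (-u)
      (by simpa only [Prod.fst_neg, Prod.snd_neg] using hu.neg_neg) hQu (by simpa using hQ) ?_,
      ?_, ?_, ?_, ne_zero_of_isCoprime hv⟩
    · intro x hx
      have := (hcr x hx).2
      rw [cross_swap v, cross_sub_right] at this
      linarith
    · intro x hx
      have := (hcr x hx).1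
      rw [cross_sub_right] at this
      simp only [cross_add_right, cross_neg_left, cross_self]
      linarith
    · rwa [cross_neg_right, ← cross_swap]
    · rw [cross_swap]; linarith
    · rw [cross_neg_right]; linarith
  obtain ⟨R, hR, hR0⟩ : ∃ R ∈ V, R ≠ 0 := by
    rcases exists_edge_or_vertex hfin hne hseg (h := (1, 0)) (by simp) with
      ⟨p, u, n, -, -, hu, hp, hq, hmax⟩ | ⟨Q, hQ, hmax⟩
    · exact ⟨u, hedge p u hu hp hq hmax, ne_zero_of_isCoprime hu⟩
    · obtain ⟨a, ha, -, -, -, -, -, ha0⟩ := hcone _ Q hQ hmax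
      exact ⟨a, ha, ha0⟩
  have hopp : ∀ v ∈ V, v ≠ 0 → (∀ x ∈ S, -1 ≤ cross v (x - P)) → Width S 2 := by
    intro v hv hv0 hv'
    refine ⟨v, hv0, fun x hx y hy => ?_⟩
    have h1 := hv x hx
    have h2 := hv' y hy
    rw [cross_sub_right] at h1 h2
    linarith
  rcases exists_edge_or_vertex hfin hne hseg (h := -R) (neg_ne_zero.2 hR0) with
    ⟨p, u, n, hn, hRu, hu, hp, hq, hmax⟩ | ⟨Q, hQ, hmax⟩
  · left
    refine hopp u (hedge p u hu hp hq hmax) (ne_zero_of_isCoprime hu) fun x hx => ?_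
    have h1 := hR x hx
    have : R = -(n • u) := by rw [← hRu, neg_neg]
    rw [this, cross_neg_left, cross_smul_left] at h1
    nlinarith
  · obtain ⟨a, ha, b, hb, hab, haT, hTb, -⟩ := hcone _ Q hQ hmax
    obtain ⟨a, ha, b, hb, hab, haT, hTb⟩ := exists_unimodular_cone (V := V) (by
      intro a ha b hb m D i j hD hi hj hij hm x hx
      have h1 := ha x hx
      have h2 := hb x hx
      have h3 : D * cross m (x - P) = i * cross a (x - P) + j * cross b (x - P) := by
        rw [← cross_smul_left, hm, cross_add_left, cross_smul_left, cross_smul_left]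
      nlinarith) (-R) (cross a b).toNat a ha b hb hab (Int.self_le_toNat _) haT hTb
    have hT := eq_smul_add_smul hab (-R)
    generalize cross (-R) b = α at *
    generalize cross a (-R) = β at *
    have hab0 : cross a b ≠ 0 := by rw [hab]; norm_num
    have hineq : ∀ x ∈ S, -1 ≤ α * cross a (x - P) + β * cross b (x - P) := by
      intro x hx
      have h1 := hR x hx
      rw [← cross_smul_left, ← cross_smul_left, ← cross_add_left, ← hT, cross_neg_left]
      linarith
    -- Here `-R = α • a + β • b` with nonnegative coefficients. The functional with the larger
    -- coefficient is at least -1 on `S`, giving width two; equal coefficients give `a + b ≥ -1`, a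
    -- triangle of size three.
    rcases lt_trichotomy α β with h | h | h
    · left
      refine hopp b hb (ne_zero_of_cross_ne_zero (x := a) (by rwa [cross_swap, neg_ne_zero]))
        fun x hx => ?_
      have h1 := ha x hx
      have h2 := hineq x hx
      by_contra! hc
      nlinarith
    · subst h
      have hα : 1 ≤ α := by
        rcases eq_or_lt_of_le haT with h | h
        · subst h
          simp at hT
          exact absurd hT hR0
        · exact h
      refine width_or_triangle_of_subset (s := 0) (Or.inl hab) ha hb fun x hx => ?_
      have h2 := hineq x hx
      by_contra! hc
      nlinarith
    · left
      refine hopp a ha (ne_zero_of_cross_ne_zero hab0) fun x hx => ?_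
      have h1 := hb x hx
      have h2 := hineq x hx
      by_contra! hc
      nlinarith

/-! ### Noncollinear interior lattice points -/

/-- The case of interior lattice points that are not collinear, with a lattice point of the polygon
at height at least two over all interior lattice points. -/
theorem width_or_triangle_of_height {S : Set (ℤ × ℤ)} (hG : {z | Inner S z}.Finite)
    {s : ℤ} (hs : 1 ≤ s) {h : ℤ × ℤ} (hh : h ≠ 0)
    (hw : ∀ x, Inner S x → ∀ y, Inner S y → cross h x - cross h y ≤ s)
    (hmin : ¬ Width {z | Inner S z} (s - 1)) {r : ℤ × ℤ} (hr : r ∈ S)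
    (hhr : ∀ z, Inner S z → cross h z + 2 ≤ cross h r) :
    Width S (s + 2) ∨ Triangle S (s + 3) := by
  have hseg := segmentClosed_inner S
  rcases exists_edge_or_vertex hG (nonempty_of_not_width hmin) hseg hh with
    ⟨p, u, n, hn, rfl, hu, hp, hq, hmax⟩ | ⟨P, hP, hmax⟩
  -- Minimality of `s` forces `n = 1`, so `r` would lie two steps beyond an edge of the interior
  -- polygon.
  · exfalso
    have h1 := cross_le_add_one hu hp hq hmax hr
    obtain ⟨x, hx, y, hy, hxy⟩ := exists_lt_of_not_width hmin (ne_zero_of_isCoprime hu)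
    have h2 := hw x hx y hy
    have h3 := hhr p hp
    simp only [cross_smul_left] at h2 h3
    nlinarith
  obtain ⟨u, v, hu, hv, hPu, hPv, huv, hcr⟩ := exists_edges hG hseg hP hmax
    fun f hf => exists_cross_ne (fun hc => hmin (hc.mono (by omega))) P hf
  have hhu : cross h u < 0 := by
    have := hmax _ hPu (by simpa using ne_zero_of_isCoprime hu)
    rw [cross_add_right] at this
    linarith
  have hhv : cross h v < 0 := by
    have := hmax _ hPv (by simpa using ne_zero_of_isCoprime hv)
    rw [cross_add_right] at this
    linarith
  have hb : ∀ x ∈ S, -cross u (x - P) ≤ 1 := by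
    intro x hx
    have := cross_le_add_one (u := -u) (p := P + u)
      (by simpa only [Prod.fst_neg, Prod.snd_neg] using hu.neg_neg) hPu (by simpa using hP)
      (by
        intro z hz
        have := (hcr z hz).1
        simp only [cross_sub_right, cross_add_right, cross_neg_left, cross_self] at this ⊢
        linarith) hx
    simp only [cross_sub_right, cross_add_right, cross_neg_left, cross_self] at this ⊢
    linarith
  have ha : ∀ x ∈ S, cross v (x - P) ≤ 1 := by
    intro x hx
    have := cross_le_add_one hv hP hPv
      (by
        intro z hz
        have := (hcr z hz).2
        rw [cross_swap v, cross_sub_right] at this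
        linarith) hx
    rw [cross_sub_right]
    linarith
  have hexp : ∀ x, cross u v * cross h (x - P) =
      -cross h u * cross v (x - P) + cross h v * cross u (x - P) := by
    intro x
    rw [cross_mul_cross, cross_swap v]
    ring
  -- `P` maximises `cross v` on the interior points, and every functional varies there by at least
  -- `s`.
  obtain ⟨B, hB, hBv⟩ : ∃ B, Inner S B ∧ cross v (B - P) ≤ -s := by
    obtain ⟨x, hx, y, hy, hxy⟩ := exists_lt_of_not_width hmin (ne_zero_of_isCoprime hv)
    have := (hcr x hx).2
    rw [cross_swap v, cross_sub_right] at this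
    refine ⟨y, hy, ?_⟩
    rw [cross_sub_right]
    linarith
  obtain ⟨C, hC, hCu⟩ : ∃ C, Inner S C ∧ s ≤ cross u (C - P) := by
    obtain ⟨x, hx, y, hy, hxy⟩ := exists_lt_of_not_width hmin (ne_zero_of_isCoprime hu)
    have := (hcr y hy).1
    rw [cross_sub_right] at this
    refine ⟨x, hx, ?_⟩
    rw [cross_sub_right]
    linarith
  have hlow : ∀ x, Inner S x → -s ≤ cross h (x - P) := by
    intro x hx
    have := hw P hP x hx
    rw [cross_sub_right]
    linarith
  have hBu := (hcr B hB).1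
  have hCv := (hcr C hC).2
  rw [cross_swap v] at hCv
  have eB := hexp B
  have eC := hexp C
  have eR := hexp r
  have lB := hlow B hB
  have lC := hlow C hC
  have lR : 2 ≤ cross h (r - P) := by
    have := hhr P hP
    rw [cross_sub_right]
    linarith
  have aR := ha r hr
  have bR := hb r hr
  -- `B` and `C` bound `-cross h u` and `-cross h v` by `cross u v`, while `r` makes their sum at
  -- least `2 * cross u v`. Hence equality holds throughout.
  have hA : -cross h u ≤ cross u v := by nlinarith
  have hB' : -cross h v ≤ cross u v := by nlinarith
  have hAD : -cross h u = cross u v := by nlinarith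
  have hBD : -cross h v = cross u v := by nlinarith
  have hsum : ∀ x, cross h (x - P) = cross v (x - P) - cross u (x - P) := by
    intro x
    have := hexp x
    refine mul_left_cancel₀ huv.ne' ?_
    rw [this, hAD, neg_eq_iff_eq_neg.1 hBD]
    ring
  have sR := hsum r
  have aR1 : cross v (r - P) = 1 := by linarith
  have bR1 : cross u (r - P) = -1 := by linarith
  have hk : cross u v • (r - P) = -(u + v) := by
    refine Prod.ext ?_ ?_
    · simp only [cross, Prod.smul_fst, smul_eq_mul, Prod.fst_neg, Prod.fst_add] at aR1 bR1 ⊢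
      linear_combination (-u.1) * aR1 + v.1 * bR1
    · simp only [cross, Prod.smul_snd, smul_eq_mul, Prod.snd_neg, Prod.snd_add] at aR1 bR1 ⊢
      linear_combination (-u.2) * aR1 + v.2 * bR1
  have hg : ∀ x, cross u v * cross (r - P) (x - P) = -(cross u (x - P) + cross v (x - P)) := by
    intro x
    rw [← cross_smul_left, hk, cross_neg_left, cross_add_left]
  have hr0 : r - P ≠ 0 := by
    intro h0
    rw [h0] at aR1
    simp [cross] at aR1
  have hbox : ∀ x, Inner S x → cross v (x - P) ≤ 0 ∧ 0 ≤ cross u (x - P) ∧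
      -s ≤ cross v (x - P) - cross u (x - P) := by
    intro x hx
    have h1 := (hcr x hx).2
    rw [cross_swap v] at h1
    have h2 := hlow x hx
    rw [hsum] at h2
    exact ⟨by linarith, (hcr x hx).1, h2⟩
  have hdet : cross u v = 1 := by
    -- On the interior points `cross u v * cross (r - P)` varies by at most `2 * s`, whereas `cross
    -- (r - P)` varies by at least `s`.
    have hk2 : cross u v ≤ 2 := by
      obtain ⟨x, hx, y, hy, hxy⟩ := exists_lt_of_not_width hmin hr0
      obtain ⟨x1, x2, x3⟩ := hbox x hx
      obtain ⟨y1, y2, y3⟩ := hbox y hy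
      have hgx := hg x
      have hgy := hg y
      simp only [cross_sub_right (r - P)] at hgx hgy
      nlinarith
    by_contra hk1
    have hk2 : cross u v = 2 := by omega
    -- Determinant two would make `h` twice an integer functional, whose width on the interior
    -- points is at most `s / 2`, below the minimum.
    have h2h : ∀ x, cross h (x - P) = 2 * cross (-(r - P) - u) (x - P) := by
      intro x
      have h1 := hg x
      have h2 := hsum x
      rw [hk2] at h1
      rw [cross_sub_left, cross_neg_left]
      linarith
    have hne : -(r - P) - u ≠ 0 := by
      intro h0
      have := h2h r
      rw [h0] at this
      simp only [cross, Prod.fst_zero, Prod.snd_zero, zero_mul, sub_zero, mul_zero] at this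
      rw [cross] at lR
      omega
    obtain ⟨x, hx, y, hy, hxy⟩ := exists_lt_of_not_width hmin hne
    have h1 := hw x hx y hy
    have h2 := h2h x
    have h3 := h2h y
    simp only [cross_sub_right] at h2 h3
    omega
  have hPB : P + s • u = B := by
    have := eq_smul_add_smul hdet (B - P)
    obtain ⟨x1, x2, x3⟩ := hbox B hB
    rw [show cross u (B - P) = 0 by linarith, show cross (B - P) v = s by rw [cross_swap]; linarith]
      at this
    rw [zero_smul, add_zero] at this
    rw [← this]
    abel
  have hPC : P + s • v = C := by
    have := eq_smul_add_smul hdet (C - P)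
    obtain ⟨x1, x2, x3⟩ := hbox C hC
    rw [show cross u (C - P) = s by linarith, show cross (C - P) v = 0 by rw [cross_swap]; linarith]
      at this
    rw [zero_smul, zero_add] at this
    rw [← this]
    abel
  have hcop : IsCoprime (u - v).1 (u - v).2 := by
    refine ⟨v.2, -v.1, ?_⟩
    rw [← hdet]
    simp only [cross, Prod.fst_sub, Prod.snd_sub]
    ring
  -- The segment from `C` to `B` lies on the third side of the interior polygon, which supplies the
  -- last inequality of the enclosing triangle.
  have hbot : ∀ x ∈ S, cross (u - v) x ≤ cross (u - v) C + 1 := by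
    intro x hx
    refine cross_le_add_one hcop hC (hseg C (u - v) s hs hC ?_) ?_ hx
    · have hCB : C + s • (u - v) = B := by
        rw [← hPC, ← hPB, smul_sub]
        abel
      rw [hCB]
      exact hB
    · intro z hz
      obtain ⟨x1, x2, x3⟩ := hbox z hz
      rw [← hPC]
      simp only [cross_sub_left, cross_sub_right, cross_add_right, cross_smul_right, cross_self,
        hdet] at *
      linarith
  refine width_or_triangle_of_subset (P := P) (a := v) (b := -u) ?_ ha ?_ ?_
  · left; rw [cross_neg_right, ← cross_swap, hdet]
  · intro x hx
    rw [cross_neg_left]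
    exact hb x hx
  · intro x hx
    have := hbot x hx
    rw [← hPC] at this
    simp only [cross_sub_left, cross_sub_right, cross_add_right, cross_smul_right, cross_self,
      hdet, cross_neg_left] at *
    linarith

/-! ### No interior lattice points -/

theorem eq_zero_of_cross_eq_zero {f u w : ℤ × ℤ} (huw : cross u w ≠ 0) (h1 : cross f u = 0)
    (h2 : cross f w = 0) : f = 0 := by
  have h : ∀ x, cross f x = 0 := by
    intro x
    have := cross_mul_cross f x u w
    rw [h1, h2] at this
    simpa [huw] using this
  have e1 := h (1, 0)
  have e2 := h (0, 1)
  simp [cross] at e1 e2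
  exact Prod.ext e2 e1

theorem exists_support_of_not_inner {S : Set (ℤ × ℤ)} {z : ℤ × ℤ} (h : ¬ Inner S z) :
    ∃ f : ℤ × ℤ, f ≠ 0 ∧ ∀ x ∈ S, cross f x ≤ cross f z := by
  unfold Inner at h
  push Not at h
  exact h

theorem exists_edge {S : Set (ℤ × ℤ)} (hfin : S.Finite) (hseg : SegmentClosed S)
    (hS : ¬ Width S 0) : ∃ p u : ℤ × ℤ, IsCoprime u.1 u.2 ∧ p ∈ S ∧ p + u ∈ S ∧
      ∀ x ∈ S, 0 ≤ cross u (x - p) := by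
  rcases exists_edge_or_vertex hfin (nonempty_of_not_width hS) hseg (h := (1, 0)) (by simp) with
      ⟨p, u, -, -, -, hu, hp, hq, hmax⟩ | ⟨Q, hQ, hmax⟩
  · refine ⟨p + u, -u, by simpa only [Prod.fst_neg, Prod.snd_neg] using hu.neg_neg, hq,
      by simpa using hp, fun x hx => ?_⟩
    have := hmax x hx
    simp only [cross_sub_right, cross_add_right, cross_neg_left, cross_self]
    linarith
  · obtain ⟨u, v, hu, -, hQu, -, -, h⟩ := exists_edges hfin hseg hQ hmax
      fun f hf => exists_cross_ne hS Q hf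
    exact ⟨Q, u, hu, hQ, hQu, fun x hx => (h x hx).1⟩

/-- A polygon without interior lattice points, with two adjacent edges on coordinate axes. -/
theorem width_or_triangle_of_corner {S : Set (ℤ × ℤ)} (hempty : ∀ z, ¬ Inner S z)
    {p u w a b : ℤ × ℤ} {h : ℤ} (hab : cross a b = 1 ∨ cross a b = -1)
    (hau : cross a u = 1) (haw : cross a w = 0) (hbw : cross b w = 1)
    (hdual : ∀ x, x = cross a x • u + cross b x • w)
    (hp : p ∈ S) (hpu : p + u ∈ S) (hph : p + h • w ∈ S) (hh : 2 ≤ h)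
    (hY : ∀ x ∈ S, 0 ≤ cross b (x - p)) : Width S 1 ∨ Triangle S 2 := by
  have hf : ∀ f x, cross f x = cross a (x - p) * cross f u + cross b (x - p) * cross f w +
      cross f p := by
    intro f x
    have := congrArg (cross f) (hdual (x - p))
    rw [cross_add_right, cross_smul_right, cross_smul_right, cross_sub_right f] at this
    linarith
  have hf0 : ∀ f, f ≠ 0 → ¬ (cross f u = 0 ∧ cross f w = 0) := by
    rintro f hf0 ⟨h1, h2⟩
    have h : ∀ x, cross f x = 0 := by
      intro x
      have := congrArg (cross f) (hdual x)
      rw [this, cross_add_right, cross_smul_right, cross_smul_right, h1, h2]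
      simp
    have e1 := h (1, 0)
    have e2 := h (0, 1)
    simp [cross] at e1 e2
    exact hf0 (Prod.ext e2 e1)
  have ha0 : a ≠ 0 := ne_zero_of_cross_ne_zero (x := u) (by rw [hau]; norm_num)
  -- In the coordinates given by `a` and `b` from `p`, a point left of the vertical axis would make
  -- (0, 1) interior.
  have hX : ∀ x ∈ S, 0 ≤ cross a (x - p) := by
    intro x hx
    by_contra! hneg
    obtain ⟨f, hf1, hmax⟩ := exists_support_of_not_inner (hempty (p + w))
    have h1 := hmax p hp
    have h2 := hmax _ hpu
    have h3 := hmax _ hph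
    have h4 := hmax x hx
    rw [hf f x] at h4
    simp only [cross_add_right, cross_smul_right] at h1 h2 h3 h4
    have hw : cross f w = 0 := by nlinarith
    rw [hw] at h2 h4
    exact hf0 f hf1 ⟨by nlinarith, hw⟩
  -- The line supporting `S` at (1, 1) has normal coefficients `cross f u > 0` and `cross f w ≥ 0`.
  -- A point with first coordinate at least 2 makes the former at most the latter; `h ≥ 2` then
  -- forces equality and `h = 2`.
  obtain ⟨f, hf1, hmax⟩ := exists_support_of_not_inner (hempty (p + u + w))
  have h1 := hmax p hp
  have h2 := hmax _ hpu
  have h3 := hmax _ hph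
  simp only [cross_add_right, cross_smul_right] at h1 h2 h3
  have hβ : 0 ≤ cross f w := by linarith
  have hα : 0 < cross f u := by
    by_contra! hα
    have hw : cross f w = 0 := by nlinarith
    exact hf0 f hf1 ⟨by nlinarith, hw⟩
  have hineq : ∀ x ∈ S, cross a (x - p) * cross f u + cross b (x - p) * cross f w ≤
      cross f u + cross f w := by
    intro x hx
    have := hmax x hx
    rw [hf f x, cross_add_right, cross_add_right] at this
    linarith
  by_cases hall : ∀ x ∈ S, cross a (x - p) ≤ 1
  · left
    refine ⟨a, ha0, fun x hx y hy => ?_⟩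
    have h4 := hall x hx
    have h5 := hX y hy
    rw [cross_sub_right] at h4 h5
    linarith
  right
  push Not at hall
  obtain ⟨x, hx, hx1⟩ := hall
  have hxi := hineq x hx
  have hx0 := hY x hx
  have hle : cross f u ≤ cross f w := by nlinarith
  have hh2 : h = 2 := by
    by_contra hne
    have : 3 ≤ h := by omega
    nlinarith
  subst hh2
  have heq : cross f u = cross f w := by linarith
  rw [heq] at hineq hα
  have hsum : ∀ y ∈ S, cross a (y - p) + cross b (y - p) ≤ 2 := by
    intro y hy
    have := hineq y hy
    by_contra! hc
    nlinarith
  have hxs := hsum x hx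
  refine ⟨a, b, -cross a p, -cross b p, hab, fun y hy => ?_, ⟨p, hp, by simp⟩, ⟨x, hx, ?_⟩,
    ⟨_, hph, ?_⟩⟩
  · have := hX y hy
    have := hY y hy
    have := hsum y hy
    simp only [cross_sub_right] at *
    refine ⟨?_, ?_, ?_⟩ <;> linarith
  · simp only [cross_sub_right] at *
    constructor <;> linarith
  · simp only [cross_add_right, cross_smul_right, haw, hbw]
    constructor <;> ring

/-- The case of a polygon without interior lattice points. -/
theorem width_or_triangle_of_no_inner {S : Set (ℤ × ℤ)} (hfin : S.Finite)
    (hseg : SegmentClosed S) (hS : ¬ Width S 0) (hempty : ∀ z, ¬ Inner S z) :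
    Width S 1 ∨ Triangle S 2 := by
  obtain ⟨p, u, hu, hp, hpu, hpos⟩ := exists_edge hfin hseg hS
  obtain ⟨r, hr, hrmax⟩ := Set.exists_max_image S (cross u) hfin (nonempty_of_not_width hS)
  rcases le_or_gt (cross u (r - p)) 1 with hle | hlt
  · left
    refine ⟨u, ne_zero_of_isCoprime hu, fun x hx y hy => ?_⟩
    have h1 := hrmax x hx
    have h2 := hpos y hy
    rw [cross_sub_right] at hle h2
    linarith
  obtain ⟨m, t, ht0, ht1, hm, hm1⟩ := exists_height_one hu p r rfl (by linarith)
  obtain ⟨f, hf, hmax⟩ := exists_support_of_not_inner (hempty m)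
  have hup : cross u (r - p) ≠ 0 := by omega
  generalize hh : cross u (r - p) = h at *
  -- For other `t` all three weights of `m` are positive, so a functional maximal at `m` is constant
  -- on the triangle, hence zero. Thus `m` lies on a side through `r`.
  have ht : t = 0 ∨ t = h - 1 := by
    by_contra! ht
    have key := congrArg (cross f) hm
    have h1 := hmax p hp
    have h2 := hmax _ hpu
    have h3 := hmax r hr
    simp only [cross_add_right, cross_smul_right] at key h2
    have h0t : 1 ≤ t := by omega
    have ht1 : 1 ≤ h - 1 - t := by omega
    have e1 := mul_nonneg (show 0 ≤ h - 1 - t - 1 by omega)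
      (show 0 ≤ cross f m - cross f p by linarith)
    have e2 := mul_nonneg (show 0 ≤ t - 1 by omega)
      (show 0 ≤ cross f m - (cross f p + cross f u) by linarith)
    have e3 : cross f p = cross f m := by nlinarith
    have e4 : cross f p + cross f u = cross f m := by nlinarith
    have e5 : cross f r = cross f m := by nlinarith
    refine hf (eq_zero_of_cross_eq_zero (u := u) (w := r - p) (by rwa [hh]) (by linarith) ?_)
    rw [cross_sub_right]
    linarith
  rcases ht with rfl | rfl
  · have hr' : p + h • (m - p) = r := by
      rw [smul_sub, hm]
      module
    have h1 : cross (m - p) u = -1 := by rw [cross_swap, hm1]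
    refine width_or_triangle_of_corner hempty (p := p) (u := u) (w := m - p) (a := -(m - p))
      (b := u) (h := h) ?_ ?_ ?_ hm1 (fun x => ?_) hp hpu (hr' ▸ hr) hlt hpos
    · left; rw [cross_neg_left, h1, neg_neg]
    · rw [cross_neg_left, h1, neg_neg]
    · rw [cross_neg_left, cross_self, neg_zero]
    · have := eq_smul_add_smul hm1 x
      rwa [cross_swap (m - p) x, ← cross_neg_left] at this
  · have hr' : p + u + h • (m - (p + u)) = r := by
      rw [smul_sub, hm]
      module
    have h1 : cross u (m - (p + u)) = 1 := by
      rw [← sub_sub, cross_sub_right, hm1, cross_self, sub_zero]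
    refine width_or_triangle_of_corner hempty (p := p + u) (u := -u) (w := m - (p + u))
      (a := m - (p + u)) (b := u) (h := h) ?_ ?_ (cross_self _) h1 (fun x => ?_) hpu
      (by simpa using hp) (hr' ▸ hr) hlt ?_
    · right; rw [cross_swap, h1]
    · rw [cross_neg_right, cross_swap, h1, neg_neg]
    · have := eq_smul_add_smul h1 x
      rwa [cross_swap (m - (p + u)) x, neg_smul, ← smul_neg] at this
    · intro x hx
      have := hpos x hx
      rwa [← sub_sub, cross_sub_right, cross_self, sub_zero]

/-! ### Assembling the upper bound -/

/-- A polygon with interior lattice points has width at most two more than its interior polygon,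
or is a standard triangle. -/
theorem width_or_triangle_of_inner {S : Set (ℤ × ℤ)} (hfin : S.Finite)
    (hseg : SegmentClosed S) (hS : ¬ Width S 0) (hG : {z | Inner S z}.Finite)
    (hne : {z | Inner S z}.Nonempty) {s : ℤ} (hs : Width {z | Inner S z} s)
    (hmin : ¬ Width {z | Inner S z} (s - 1)) : Width S (s + 2) ∨ Triangle S (s + 3) := by
  obtain ⟨f, hf, hw⟩ := hs
  obtain ⟨P, hP⟩ := hne
  have hs0 : 0 ≤ s := by simpa using hw P hP P hP
  rcases eq_or_lt_of_le hs0 with rfl | hs0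
  · rcases exists_edge_or_vertex hG ⟨P, hP⟩ (segmentClosed_inner S) hf with
      ⟨p, u, n, hn, rfl, hu, hp, hq, hmax⟩ | ⟨Q, hQ, hmax⟩
    · left
      have hle : ∀ z, Inner S z → cross (-u) z ≤ cross (-u) (p + u) := by
        intro z hz
        have := hw p hp z hz
        simp only [cross_smul_left, cross_neg_left, cross_add_right, cross_self] at this ⊢
        nlinarith
      refine ⟨u, ne_zero_of_isCoprime hu, fun x hx y hy => ?_⟩
      have h1 := cross_le_add_one hu hp hq hmax hx
      have h2 := cross_le_add_one (u := -u) (p := p + u)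
        (by simpa only [Prod.fst_neg, Prod.snd_neg] using hu.neg_neg) hq (by simpa using hp) hle hy
      simp only [cross_neg_left, cross_add_right, cross_self] at h2
      linarith
    · refine width_or_triangle_of_unique_inner hfin hseg hS hQ fun z hz => ?_
      by_contra hzQ
      have := hmax z hz hzQ
      have := hw Q hQ z hz
      linarith
  · by_cases h1 : ∃ r ∈ S, ∀ z, Inner S z → cross f z + 2 ≤ cross f r
    · obtain ⟨r, hr, h1⟩ := h1
      exact width_or_triangle_of_height hG hs0 hf hw hmin hr h1
    by_cases h2 : ∃ r ∈ S, ∀ z, Inner S z → cross (-f) z + 2 ≤ cross (-f) r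
    · obtain ⟨r, hr, h2⟩ := h2
      refine width_or_triangle_of_height hG hs0 (neg_ne_zero.2 hf) ?_ hmin hr h2
      intro x hx y hy
      have := hw y hy x hx
      simp only [cross_neg_left]
      linarith
    · left
      push Not at h1 h2
      refine ⟨f, hf, fun x hx y hy => ?_⟩
      obtain ⟨z, hz, hz'⟩ := h1 x hx
      obtain ⟨t, ht, ht'⟩ := h2 y hy
      have := hw z hz t ht
      simp only [cross_neg_left] at ht'
      linarith

/-! ### Lower bounds and the widths of triangles -/

theorem Width.inner {S : Set (ℤ × ℤ)} {n : ℤ} (h : Width S n) :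
    Width {z | Inner S z} (n - 2) := by
  obtain ⟨f, hf, hw⟩ := h
  refine ⟨f, hf, fun x hx y hy => ?_⟩
  obtain ⟨x', hx', h1⟩ := hx f hf
  obtain ⟨y', hy', h2⟩ := Inner.exists_lt hy hf
  have := hw x' hx' y' hy'
  linarith

theorem Width.nonneg {S : Set (ℤ × ℤ)} {n : ℤ} (h : Width S n) (hS : S.Nonempty) : 0 ≤ n := by
  obtain ⟨f, hf, hw⟩ := h
  obtain ⟨x, hx⟩ := hS
  simpa using hw x hx x hx

theorem Triangle.width {S : Set (ℤ × ℤ)} {d : ℤ} (h : Triangle S d) : Width S d := by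
  obtain ⟨a, b, c, e, hab, hS, -⟩ := h
  refine ⟨a, ne_zero_of_cross_ne_zero (x := b) (by rcases hab with h | h <;> rw [h] <;> norm_num),
    fun x hx y hy => ?_⟩
  have := hS x hx
  have := hS y hy
  linarith

/-- Up to sign, values of `f` at the vertices differ by `d * cross f a` and `d * cross f b`,
multiples of `d` that cannot both vanish. -/
theorem Triangle.le_of_width {S : Set (ℤ × ℤ)} {d n : ℤ} (hd : 0 ≤ d) (h : Triangle S d)
    (hw : Width S n) : d ≤ n := by
  obtain ⟨a, b, c, e, hab, hS, ⟨x, hx, hx1, hx2⟩, ⟨y, hy, hy1, hy2⟩, ⟨z, hz, hz1, hz2⟩⟩ := h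
  obtain ⟨f, hf, hw⟩ := hw
  have key : ∀ t, cross a b * cross f t = cross f a * cross t b + cross f b * cross a t :=
    fun t => cross_mul_cross f t a b
  have hab0 : cross a b ≠ 0 := by rcases hab with h | h <;> rw [h] <;> norm_num
  have hor : cross f a ≠ 0 ∨ cross f b ≠ 0 := by
    by_contra! hc
    exact hf (eq_zero_of_cross_eq_zero hab0 hc.1 hc.2)
  have kx := key x
  have ky := key y
  have kz := key z
  rw [cross_swap b x] at kx
  rw [cross_swap b y] at ky
  rw [cross_swap b z] at kz
  have e1 := hw x hx y hy
  have e2 := hw y hy x hx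
  have e3 := hw x hx z hz
  have e4 := hw z hz x hx
  have hy' : cross a b * (cross f y - cross f x) = cross f b * d := by
    rw [show cross b y = cross b x by linarith] at ky
    rw [show cross a y = cross a x + d by linarith] at ky
    linarith
  have hz' : cross a b * (cross f z - cross f x) = - (cross f a * d) := by
    rw [show cross b z = cross b x + d by linarith] at kz
    rw [show cross a z = cross a x by linarith] at kz
    linarith
  have hn := Width.nonneg ⟨f, hf, hw⟩ ⟨x, hx⟩
  by_contra! hlt
  have hsmall : ∀ k t : ℤ, t ≤ n → -n ≤ t → (k * d = t ∨ k * d = -t) → k = 0 := by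
    intro k t h1 h2 h3
    by_contra hk
    rcases lt_or_gt_of_ne hk with hk | hk <;> rcases h3 with h3 | h3 <;> nlinarith
  rcases hor with h | h
  · refine h (hsmall _ (cross f z - cross f x) (by linarith) (by linarith) ?_)
    rcases hab with h | h <;> rw [h] at hz'
    · right; linarith
    · left; linarith
  · refine h (hsmall _ (cross f y - cross f x) (by linarith) (by linarith) ?_)
    rcases hab with h | h <;> rw [h] at hy'
    · left; linarith
    · right; linarith

/-- By integrality an interior point is at least one step inside each of the three sides. -/
theorem Triangle.inner_width {S : Set (ℤ × ℤ)} {d : ℤ} (h : Triangle S d) :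
    Width {z | Inner S z} (d - 3) := by
  obtain ⟨a, b, c, e, hab, hS, -⟩ := h
  have hab0 : cross a b ≠ 0 := by rcases hab with h | h <;> rw [h] <;> norm_num
  have ha : a ≠ 0 := ne_zero_of_cross_ne_zero hab0
  have hb : b ≠ 0 := ne_zero_of_cross_ne_zero (x := a) (by rwa [cross_swap, neg_ne_zero])
  have hc : a + b ≠ 0 := ne_zero_of_cross_ne_zero (x := b)
    (by rwa [cross_add_left, cross_self, add_zero])
  have key : ∀ z, Inner S z → 1 ≤ cross a z + c ∧ 1 ≤ cross b z + e ∧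
      cross a z + c + (cross b z + e) ≤ d - 1 := by
    intro z hz
    obtain ⟨x, hx, h1⟩ := hz.exists_lt ha
    obtain ⟨y, hy, h2⟩ := hz.exists_lt hb
    obtain ⟨t, ht, h3⟩ := hz _ hc
    have := hS x hx
    have := hS y hy
    have := hS t ht
    simp only [cross_add_left] at h3
    refine ⟨?_, ?_, ?_⟩ <;> linarith
  refine ⟨a, ha, fun x hx y hy => ?_⟩
  have := key x hx
  have := key y hy
  linarith

/-! ### From the real plane to lattice points -/

/-- The real extension of the functional `cross f`. -/
def realCross (f : ℤ × ℤ) (x : Fin 2 → ℝ) : ℝ := f.1 * x 1 - f.2 * x 0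

/-- The inclusion of pairs of integers in the plane. -/
def ofPair (x : ℤ × ℤ) : Fin 2 → ℝ := ofInt ![x.1, x.2]

/-- The pairs of integers that lie in a subset of the plane. -/
def pairs (Δ : Set (Fin 2 → ℝ)) : Set (ℤ × ℤ) := {x | ofPair x ∈ Δ}

@[simp] theorem ofPair_zero_apply (x : ℤ × ℤ) : ofPair x 0 = x.1 := rfl

@[simp] theorem ofPair_one_apply (x : ℤ × ℤ) : ofPair x 1 = x.2 := rfl

theorem realCross_ofPair (f x : ℤ × ℤ) : realCross f (ofPair x) = cross f x := by
  simp [realCross, cross]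

theorem range_ofPair : Set.range ofPair = latticePoints := by
  ext y
  constructor
  · rintro ⟨x, rfl⟩; exact ⟨_, rfl⟩
  · rintro ⟨z, rfl⟩
    refine ⟨(z 0, z 1), ?_⟩
    ext i
    fin_cases i <;> rfl

theorem image_ofPair_pairs (Δ : Set (Fin 2 → ℝ)) : ofPair '' pairs Δ = Δ ∩ latticePoints := by
  rw [← range_ofPair]
  exact Set.image_preimage_eq_inter_range

theorem isLinearMap_realCross (f : ℤ × ℤ) : IsLinearMap ℝ (realCross f) := by
  constructor
  · intro x y; simp only [realCross, Pi.add_apply]; ring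
  · intro c x; simp only [realCross, Pi.smul_apply, smul_eq_mul]; ring

theorem realCross_neg (f : ℤ × ℤ) (x : Fin 2 → ℝ) : realCross (-f) x = -realCross f x := by
  simp only [realCross, Prod.fst_neg, Prod.snd_neg]; push_cast; ring

theorem realCross_le_of_mem_convexHull {T : Set (ℤ × ℤ)} {f : ℤ × ℤ} {n : ℤ}
    (h : ∀ x ∈ T, cross f x ≤ n) {y : Fin 2 → ℝ} (hy : y ∈ convexHull ℝ (ofPair '' T)) :
    realCross f y ≤ n := by
  refine convexHull_min (t := {y | realCross f y ≤ n}) ?_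
    (convex_halfSpace_le (isLinearMap_realCross f) _) hy
  rintro _ ⟨x, hx, rfl⟩
  simp only [Set.mem_ofPred_eq, realCross_ofPair]
  exact_mod_cast h x hx

theorem le_realCross_of_mem_convexHull {T : Set (ℤ × ℤ)} {f : ℤ × ℤ} {n : ℤ}
    (h : ∀ x ∈ T, n ≤ cross f x) {y : Fin 2 → ℝ} (hy : y ∈ convexHull ℝ (ofPair '' T)) :
    n ≤ realCross f y := by
  have := realCross_le_of_mem_convexHull (f := -f) (n := -n)
    (fun x hx => by rw [cross_neg_left]; linarith [h x hx]) hy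
  rw [realCross_neg] at this
  push_cast at this
  linarith

theorem finite_pairs {Δ : Set (Fin 2 → ℝ)} (h : Bornology.IsBounded Δ) : (pairs Δ).Finite := by
  obtain ⟨R, hR⟩ := h.exists_norm_le
  obtain ⟨n, hn⟩ := exists_nat_ge R
  refine (Set.finite_Icc ((-n, -n) : ℤ × ℤ) (n, n)).subset fun x hx => ?_
  have h0 := (norm_le_pi_norm _ 0).trans ((hR _ hx).trans hn)
  have h1 := (norm_le_pi_norm _ 1).trans ((hR _ hx).trans hn)
  rw [Real.norm_eq_abs, abs_le] at h0 h1
  simp only [ofPair_zero_apply, ofPair_one_apply] at h0 h1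
  refine ⟨⟨?_, ?_⟩, ⟨?_, ?_⟩⟩
  · exact_mod_cast h0.1
  · exact_mod_cast h1.1
  · exact_mod_cast h0.2
  · exact_mod_cast h1.2

theorem IsLatticePolygon.eq_convexHull {Δ : Set (Fin 2 → ℝ)} (h : IsLatticePolygon Δ) :
    Δ = convexHull ℝ (ofPair '' pairs Δ) := by
  obtain ⟨S, -, hS, rfl⟩ := h
  rw [image_ofPair_pairs]
  refine subset_antisymm (convexHull_mono fun x hx => ⟨subset_convexHull ℝ S hx, hS hx⟩) ?_
  exact convexHull_min Set.inter_subset_left (convex_convexHull ℝ S)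

theorem segmentClosed_pairs {Δ : Set (Fin 2 → ℝ)} (h : Convex ℝ Δ) : SegmentClosed (pairs Δ) := by
  intro x u n hn hx hy
  have hn' : (1 : ℝ) ≤ n := by exact_mod_cast hn
  have hn0 : (n : ℝ) ≠ 0 := by linarith
  have := h hx hy (a := 1 - 1 / n) (b := 1 / n)
    (by rw [sub_nonneg]; exact div_le_one_of_le₀ hn' (by linarith)) (by positivity) (by ring)
  have he : ofPair (x + u) = (1 - 1 / (n : ℝ)) • ofPair x + (1 / (n : ℝ)) • ofPair (x + n • u) := by
    ext i
    fin_cases i <;> simp <;> field_simp <;> ring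
  rw [← he] at this
  exact this

theorem sq_add_sq_pos {f : ℤ × ℤ} (hf : f ≠ 0) : 0 < f.1 ^ 2 + f.2 ^ 2 := by
  have : f.1 ≠ 0 ∨ f.2 ≠ 0 := by
    by_contra! hc
    exact hf (Prod.ext hc.1 hc.2)
  rcases this with h | h <;> positivity

theorem exists_lt_of_mem_interior {Δ : Set (Fin 2 → ℝ)} {y : Fin 2 → ℝ} (hy : y ∈ interior Δ)
    {f : ℤ × ℤ} (hf : f ≠ 0) : ∃ y' ∈ Δ, realCross f y < realCross f y' := by
  -- The gradient of `realCross f`, along which the functional increases.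
  let v : Fin 2 → ℝ := ![-f.2, f.1]
  have hcont : Continuous fun ε : ℝ => y + ε • v := by fun_prop
  have hev : ∀ᶠ ε in nhds (0 : ℝ), y + ε • v ∈ Δ := by
    refine hcont.continuousAt.eventually_mem ?_
    simpa using mem_interior_iff_mem_nhds.1 hy
  obtain ⟨ε, h1, h2⟩ := ((hev.filter_mono nhdsWithin_le_nhds).and
    (self_mem_nhdsWithin (a := (0 : ℝ)) (s := Set.Ioi 0))).exists
  refine ⟨_, h1, ?_⟩
  have hε : 0 < ε := h2
  have hN : (0 : ℝ) < f.1 ^ 2 + f.2 ^ 2 := by exact_mod_cast sq_add_sq_pos hf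
  rw [(isLinearMap_realCross f).map_add, (isLinearMap_realCross f).map_smul]
  have : realCross f v = f.1 ^ 2 + f.2 ^ 2 := by simp [realCross, v]; ring
  rw [this, smul_eq_mul]
  linarith [mul_pos hε hN]

/-- A real supporting line of a finite set of lattice points through a lattice point can be
replaced by a rational one. -/
theorem exists_int_support {T : Set (ℤ × ℤ)} (hT : T.Finite) {z : ℤ × ℤ} {α β : ℝ}
    (hαβ : ¬ (α = 0 ∧ β = 0))
    (h : ∀ x ∈ T, α * x.1 + β * x.2 ≤ α * z.1 + β * z.2) :
    ∃ f : ℤ × ℤ, f ≠ 0 ∧ ∀ x ∈ T, cross f x ≤ cross f z := by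
  -- A second lattice point on the line makes its direction integral. Otherwise the finitely many
  -- inequalities are strict, and the normal can be perturbed to a rational one.
  by_cases hx : ∃ x ∈ T, x ≠ z ∧ α * x.1 + β * x.2 = α * z.1 + β * z.2
  · obtain ⟨x, hx, hxz, he⟩ := hx
    have hd0 : x - z ≠ 0 := sub_ne_zero.2 hxz
    have hd : α * ((x - z).1 : ℤ) + β * ((x - z).2 : ℤ) = 0 := by
      simp only [Prod.fst_sub, Prod.snd_sub]; push_cast; linarith
    generalize x - z = d at *
    have hN : (0 : ℝ) < d.1 ^ 2 + d.2 ^ 2 := by exact_mod_cast sq_add_sq_pos hd0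
    have hα : (d.1 ^ 2 + d.2 ^ 2) * α = -(β * d.1 - α * d.2) * d.2 := by
      linear_combination d.1 * hd
    have hβ : (d.1 ^ 2 + d.2 ^ 2) * β = (β * d.1 - α * d.2) * d.1 := by
      linear_combination d.2 * hd
    set k := β * d.1 - α * d.2
    have hk : k ≠ 0 := by
      intro hk
      rw [hk] at hα hβ
      simp only [neg_zero, zero_mul, mul_eq_zero, hN.ne', false_or] at hα hβ
      exact hαβ ⟨hα, hβ⟩
    have key : ∀ y ∈ T, k * ((cross d y : ℤ) : ℝ) ≤ k * ((cross d z : ℤ) : ℝ) := by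
      intro y hy
      have := mul_le_mul_of_nonneg_left (h y hy) hN.le
      simp only [cross]
      push_cast
      linear_combination this - (y.1 - z.1) * hα - (y.2 - z.2) * hβ
    rcases lt_or_gt_of_ne hk with hk | hk
    · refine ⟨-d, neg_ne_zero.2 hd0, fun y hy => ?_⟩
      have := key y hy
      rw [mul_le_mul_left_of_neg hk] at this
      rw [cross_neg_left, cross_neg_left, neg_le_neg_iff]
      exact_mod_cast this
    · refine ⟨d, hd0, fun y hy => ?_⟩
      have := key y hy
      rw [mul_le_mul_iff_right₀ hk] at this
      exact_mod_cast this
  · have hlt : ∀ x ∈ T \ {z}, α * (x.1 - z.1) + β * (x.2 - z.2) < 0 := by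
      intro x hxT
      have h1 := h x hxT.1
      have h2 : α * x.1 + β * x.2 ≠ α * z.1 + β * z.2 := fun he => hx ⟨x, hxT.1, hxT.2, he⟩
      have h3 := lt_of_le_of_ne h1 h2
      linarith
    let U : Set (ℝ × ℝ) := {p | p ≠ 0} ∩ ⋂ x ∈ T \ {z},
      {p | p.1 * ((x.1 : ℝ) - z.1) + p.2 * ((x.2 : ℝ) - z.2) < 0}
    have hU : IsOpen U := by
      refine isOpen_ne.inter ((hT.subset Set.sdiff_subset).isOpen_biInter fun x _ => ?_)
      exact isOpen_lt (by fun_prop) (by fun_prop)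
    have hne : U.Nonempty := by
      refine ⟨(α, β), ?_, ?_⟩
      · intro h0
        exact hαβ ⟨congrArg Prod.fst h0, congrArg Prod.snd h0⟩
      · simp only [Set.mem_iInter]
        exact hlt
    have hdense : DenseRange (Prod.map ((↑) : ℚ → ℝ) ((↑) : ℚ → ℝ)) :=
      Rat.denseRange_cast.prodMap Rat.denseRange_cast
    obtain ⟨⟨q, r⟩, hq0, hq⟩ := hdense.exists_mem_open hU hne
    simp only [Set.mem_iInter] at hq
    have hnum : ∀ q : ℚ, (q.num : ℝ) = q * q.den := by
      intro q
      exact_mod_cast (Rat.mul_den_eq_num q).symm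
    -- The rational normal `(q, r)` with denominators cleared, rotated to match the convention of
    -- `cross`.
    refine ⟨(r.num * q.den, -(q.num * r.den)), ?_, ?_⟩
    · intro h0
      have h1 := congrArg Prod.fst h0
      have h2 := congrArg Prod.snd h0
      simp at h1 h2
      apply hq0
      simp [h1, h2]
    · intro x hxT
      rcases eq_or_ne x z with rfl | hxz
      · rfl
      have := hq x ⟨hxT, hxz⟩
      simp only [Set.mem_ofPred_eq, Prod.map_fst, Prod.map_snd] at this
      have hpos : (0 : ℝ) < q.den * r.den := by
        have := q.den_pos
        have := r.den_pos
        positivity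
      have h1 := mul_neg_of_pos_of_neg hpos this
      have h2 : ((cross (r.num * q.den, -(q.num * r.den)) x : ℤ) : ℝ) ≤
          ((cross (r.num * q.den, -(q.num * r.den)) z : ℤ) : ℝ) := by
        simp only [cross]
        push_cast
        rw [hnum q, hnum r]
        linarith
      exact_mod_cast h2

theorem exists_support_of_notMem_interior {Δ : Set (Fin 2 → ℝ)} (hΔ : Convex ℝ Δ)
    (hint : (interior Δ).Nonempty) {z : Fin 2 → ℝ} (hz : z ∉ interior Δ) :
    ∃ α β : ℝ, ¬ (α = 0 ∧ β = 0) ∧ ∀ x ∈ Δ, α * x 0 + β * x 1 ≤ α * z 0 + β * z 1 := by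
  obtain ⟨f, hf⟩ := geometric_hahn_banach_open_point hΔ.interior isOpen_interior hz
  have hcoord : ∀ x, f x = f (Pi.single 0 1) * x 0 + f (Pi.single 1 1) * x 1 := by
    intro x
    have : x = x 0 • (Pi.single 0 1 : Fin 2 → ℝ) + x 1 • (Pi.single 1 1 : Fin 2 → ℝ) := by
      ext i
      fin_cases i <;> simp
    conv_lhs => rw [this]
    rw [map_add, map_smul, map_smul, smul_eq_mul, smul_eq_mul]
    ring
  refine ⟨f (Pi.single 0 1), f (Pi.single 1 1), ?_, fun x hx => ?_⟩
  · rintro ⟨h1, h2⟩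
    obtain ⟨y, hy⟩ := hint
    have := hf y hy
    rw [hcoord y, hcoord z, h1, h2] at this
    simp at this
  · rw [← hcoord, ← hcoord]
    -- Separation bounds the functional only on the interior; its closure contains Δ since the
    -- interior is nonempty.
    have hcl : x ∈ closure (interior Δ) := by
      rw [hΔ.closure_interior_eq_closure_of_nonempty_interior hint]
      exact subset_closure hx
    have hsub : closure (interior Δ) ⊆ {y | f y ≤ f z} :=
      closure_minimal (fun y hy => (hf y hy).le) (isClosed_le f.continuous continuous_const)
    exact hsub hcl

theorem interior_nonempty_of_dim {Δ : Set (Fin 2 → ℝ)} (hΔ : Convex ℝ Δ) (hdim : dim Δ = 2) :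
    (interior Δ).Nonempty := by
  rw [hΔ.interior_nonempty_iff_affineSpan_eq_top]
  have hne : (affineSpan ℝ Δ : Set (Fin 2 → ℝ)).Nonempty := by
    rw [affineSpan_nonempty]
    by_contra hc
    rw [Set.not_nonempty_iff_eq_empty] at hc
    subst hc
    rw [dim, AffineSubspace.span_empty, AffineSubspace.direction_bot, finrank_bot] at hdim
    norm_num at hdim
  rw [← AffineSubspace.direction_eq_top_iff_of_nonempty hne]
  apply Submodule.eq_top_of_finrank_eq
  rw [show Module.finrank ℝ (affineSpan ℝ Δ).direction = 2 from hdim]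
  simp

theorem inner_iff_mem_interior {Δ : Set (Fin 2 → ℝ)} (hΔ : IsLatticePolygon Δ)
    (hint : (interior Δ).Nonempty) (z : ℤ × ℤ) :
    Inner (pairs Δ) z ↔ ofPair z ∈ interior Δ := by
  have heq := hΔ.eq_convexHull
  have hconv : Convex ℝ Δ := by rw [heq]; exact convex_convexHull ℝ _
  constructor
  · intro h
    by_contra hz
    obtain ⟨α, β, hαβ, hsup⟩ := exists_support_of_notMem_interior hconv hint hz
    obtain ⟨f, hf, hle⟩ := exists_int_support (finite_pairs hΔ.isBounded) hαβ
      fun x hx => hsup (ofPair x) hx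
    obtain ⟨x, hx, hlt⟩ := h f hf
    exact absurd (hle x hx) (not_le.2 hlt)
  · intro hz f hf
    obtain ⟨y, hy, hlt⟩ := exists_lt_of_mem_interior hz hf
    by_contra! hc
    rw [heq] at hy
    have := realCross_le_of_mem_convexHull hc hy
    rw [realCross_ofPair] at hlt
    linarith

theorem not_width_zero {Δ : Set (Fin 2 → ℝ)} (hΔ : IsLatticePolygon Δ)
    (hint : (interior Δ).Nonempty) : ¬ Width (pairs Δ) 0 := by
  have heq := hΔ.eq_convexHull
  rintro ⟨f, hf, hw⟩
  obtain ⟨y, hy⟩ := hint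
  obtain ⟨y', hy', hlt⟩ := exists_lt_of_mem_interior hy hf
  have hy := interior_subset hy
  rw [heq] at hy hy'
  obtain ⟨_, x, hx, rfl⟩ := convexHull_nonempty_iff.1 ⟨y, hy⟩
  have h1 := realCross_le_of_mem_convexHull (n := cross f x)
    (fun t ht => by linarith [hw t ht x hx]) hy'
  have h2 := le_realCross_of_mem_convexHull (n := cross f x)
    (fun t ht => by linarith [hw x hx t ht]) hy
  linarith

/-! ### Unimodular coordinates, lattice width and standard triangles -/

/-- `ℤ`-affine transformations in coordinates. -/
theorem IsZAffine.exists_coord {φ : (Fin 2 → ℝ) → (Fin 2 → ℝ)} (h : IsZAffine φ) :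
    ∃ (a b : ℤ × ℤ) (c e : ℤ), (cross a b = 1 ∨ cross a b = -1) ∧
      ∀ x, φ x 0 = realCross a x + c ∧ φ x 1 = realCross b x + e := by
  obtain ⟨A, t, h⟩ := h
  refine ⟨(A 0 1, -A 0 0), (A 1 1, -A 1 0), t 0, t 1, ?_, fun x => ?_⟩
  · have hu := (Matrix.isUnit_iff_isUnit_det _).1 A.isUnit
    rw [Matrix.det_fin_two] at hu
    have := Int.isUnit_iff.1 hu
    simp only [cross]
    convert this using 2 <;> ring
  · rw [h]
    simp only [Matrix.mulVec, dotProduct, Fin.sum_univ_two, Pi.add_apply, Matrix.map_apply, ofInt,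
      realCross]
    push_cast
    constructor <;> ring

theorem isZAffine_of_coord {a b : ℤ × ℤ} (c e : ℤ) (hab : cross a b = 1 ∨ cross a b = -1) :
    IsZAffine fun x => ![realCross a x + c, realCross b x + e] := by
  have hdet : IsUnit (!![-a.2, a.1; -b.2, b.1] : Matrix (Fin 2) (Fin 2) ℤ).det := by
    rw [Matrix.det_fin_two_of, Int.isUnit_iff]
    simp only [cross] at hab
    convert hab using 2 <;> ring
  refine ⟨Matrix.GeneralLinearGroup.mk'' _ hdet, ![c, e], fun x => ?_⟩
  have hA : ((Matrix.GeneralLinearGroup.mk'' _ hdet : GL (Fin 2) ℤ) : Matrix (Fin 2) (Fin 2) ℤ) =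
    !![-a.2, a.1; -b.2, b.1] := rfl
  rw [hA]
  ext i
  fin_cases i
  · simp [ofInt, realCross]
    ring
  · simp [ofInt, realCross]
    ring

/-- The second coordinate of a transformation is a nonzero functional up to translation. Conversely,
dividing a functional by its content does not increase its width, and a primitive one extends to a
unimodular matrix. -/
theorem mem_stripWidths_iff {T : Set (ℤ × ℤ)} (hT : T.Finite) (hne : T.Nonempty) (n : ℕ) :
    n ∈ stripWidths (convexHull ℝ (ofPair '' T)) ↔ Width T n := by
  constructor
  · rintro ⟨φ, hφ, hsub⟩
    obtain ⟨a, b, c, e, hab, h⟩ := hφ.exists_coord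
    have hab0 : cross a b ≠ 0 := by rcases hab with h | h <;> rw [h] <;> norm_num
    refine ⟨b, ne_zero_of_cross_ne_zero (x := a) (by rwa [cross_swap, neg_ne_zero]),
      fun x hx y hy => ?_⟩
    have hmem : ∀ x ∈ T, 0 ≤ cross b x + e ∧ cross b x + e ≤ n := by
      intro x hx
      have := hsub ⟨_, subset_convexHull ℝ _ ⟨x, hx, rfl⟩, rfl⟩
      simp only [strip, Set.mem_ofPred_eq, (h _).2, realCross_ofPair] at this
      exact_mod_cast this
    linarith [hmem x hx, hmem y hy]
  · rintro ⟨f, hf, hw⟩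
    obtain ⟨k, u, hk, hu, rfl⟩ := exists_eq_smul_isCoprime hf
    obtain ⟨w, hw1⟩ := exists_cross_eq_one hu
    obtain ⟨y, hy, hmin⟩ := Set.exists_min_image T (cross u) hT hne
    refine ⟨_, isZAffine_of_coord 0 (-cross u y) (a := w) (b := u)
      (by right; rw [cross_swap, hw1]), ?_⟩
    rintro _ ⟨x, hx, rfl⟩
    have h1 := le_realCross_of_mem_convexHull hmin hx
    have h2 := realCross_le_of_mem_convexHull (n := cross u y + n) (fun t ht => by
      have h1 := hw t ht y hy
      have h2 := hmin t ht
      simp only [cross_smul_left] at h1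
      nlinarith) hx
    simp only [strip, Set.mem_ofPred_eq, Matrix.cons_val_one]
    push_cast at h2 ⊢
    constructor
    · simpa using h1
    · simp; linarith

theorem exists_lw_eq {T : Set (ℤ × ℤ)} (hT : T.Finite) (hne : T.Nonempty) :
    ∃ s : ℕ, lw (convexHull ℝ (ofPair '' T)) = s ∧ Width T s ∧ ¬ Width T (s - 1) := by
  have hΔ : convexHull ℝ (ofPair '' T) ≠ ∅ := by
    rw [← Set.nonempty_iff_ne_empty, convexHull_nonempty_iff]
    exact hne.image _
  have hsw : (stripWidths (convexHull ℝ (ofPair '' T))).Nonempty :=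
    stripWidths_nonempty (isBounded_convexHull.2 (hT.image _).isBounded)
  refine ⟨sInf (stripWidths (convexHull ℝ (ofPair '' T))), by rw [lw, if_neg hΔ],
    (mem_stripWidths_iff hT hne _).1 (Nat.sInf_mem hsw), fun h => ?_⟩
  have h0 := h.nonneg hne
  generalize hs : sInf (stripWidths (convexHull ℝ (ofPair '' T))) = s at *
  -- The natural subtraction is not truncated, because `h0` gives `1 ≤ s`.
  have hs1 : ((s - 1 : ℕ) : ℤ) = (s : ℤ) - 1 := by omega
  rw [← hs1, ← mem_stripWidths_iff hT hne] at h
  have := Nat.sInf_le h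
  omega

theorem mem_smul_stdTriangle {d : ℕ} (hd : 0 < d) (x : Fin 2 → ℝ) :
    x ∈ (d : ℝ) • stdTriangle ↔ 0 ≤ x 0 ∧ 0 ≤ x 1 ∧ x 0 + x 1 ≤ d := by
  have hd' : (0 : ℝ) < d := by exact_mod_cast hd
  rw [stdTriangle, ← convexHull_smul]
  constructor
  · intro hx
    have hlin : ∀ i : Fin 2, IsLinearMap ℝ fun x : Fin 2 → ℝ => x i :=
      fun i => ⟨fun _ _ => rfl, fun _ _ => rfl⟩
    have hconv : Convex ℝ ({x : Fin 2 → ℝ | 0 ≤ x 0} ∩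
        ({x : Fin 2 → ℝ | 0 ≤ x 1} ∩ {x : Fin 2 → ℝ | x 0 + x 1 ≤ d})) :=
      (convex_halfSpace_ge (hlin 0) 0).inter ((convex_halfSpace_ge (hlin 1) 0).inter
        (convex_halfSpace_le ⟨fun x y => by simp only [Pi.add_apply]; ring,
          fun c x => by simp only [Pi.smul_apply, smul_eq_mul]; ring⟩ _))
    refine convexHull_min ?_ hconv hx
    rintro _ ⟨y, hy, rfl⟩
    rcases hy with rfl | rfl | rfl <;> simp
  · rintro ⟨h0, h1, h2⟩
    have hc := convex_convexHull ℝ ((d : ℝ) • ({![0, 0], ![1, 0], ![0, 1]} : Set (Fin 2 → ℝ)))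
    have m0 := subset_convexHull ℝ ((d : ℝ) • ({![0, 0], ![1, 0], ![0, 1]} : Set (Fin 2 → ℝ)))
      (Set.smul_mem_smul_set (a := (d : ℝ)) (b := ![0, 0]) (by simp))
    have m1 := subset_convexHull ℝ ((d : ℝ) • ({![0, 0], ![1, 0], ![0, 1]} : Set (Fin 2 → ℝ)))
      (Set.smul_mem_smul_set (a := (d : ℝ)) (b := ![1, 0]) (by simp))
    have m2 := subset_convexHull ℝ ((d : ℝ) • ({![0, 0], ![1, 0], ![0, 1]} : Set (Fin 2 → ℝ)))
      (Set.smul_mem_smul_set (a := (d : ℝ)) (b := ![0, 1]) (by simp))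
    have := hc.sum_mem (t := Finset.univ) (w := ![1 - x 0 / d - x 1 / d, x 0 / d, x 1 / d])
      (z := ![(d : ℝ) • ![0, 0], (d : ℝ) • ![1, 0], (d : ℝ) • ![0, 1]])
      (by
        intro i _
        fin_cases i
        · have : x 0 / d + x 1 / d ≤ 1 := by
            rw [← add_div]
            exact div_le_one_of_le₀ h2 hd'.le
          simp only [Fin.zero_eta, Matrix.cons_val_zero]
          linarith
        · exact div_nonneg h0 hd'.le
        · exact div_nonneg h1 hd'.le)
      (by simp [Fin.sum_univ_three]; ring)
      (by
        intro i _
        fin_cases i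
        · exact m0
        · exact m1
        · exact m2)
    convert this using 1
    ext i
    fin_cases i
    · simp [Fin.sum_univ_three]; field_simp
    · simp [Fin.sum_univ_three]; field_simp

theorem equivalent_smul_stdTriangle_iff {Δ : Set (Fin 2 → ℝ)} (hΔ : IsLatticePolygon Δ) {d : ℕ}
    (hd : 0 < d) : Equivalent Δ ((d : ℝ) • stdTriangle) ↔ Triangle (pairs Δ) d := by
  have heq := hΔ.eq_convexHull
  constructor
  · rintro ⟨φ, hφ, him⟩
    obtain ⟨a, b, c, e, hab, h⟩ := hφ.exists_coord
    have hlat : ∀ i j : ℤ, 0 ≤ i → 0 ≤ j → i + j ≤ d →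
        ∃ x ∈ pairs Δ, cross a x + c = i ∧ cross b x + e = j := by
      intro i j hi hj hij
      have hmem : ofPair (i, j) ∈ (d : ℝ) • stdTriangle := by
        rw [mem_smul_stdTriangle hd]
        simp only [ofPair_zero_apply, ofPair_one_apply]
        exact ⟨by exact_mod_cast hi, by exact_mod_cast hj, by exact_mod_cast hij⟩
      rw [← him] at hmem
      obtain ⟨y, hy, hyφ⟩ := hmem
      have e1 : realCross a y + c = i := by rw [← (h y).1, hyφ, ofPair_zero_apply]
      have e2 : realCross b y + e = j := by rw [← (h y).2, hyφ, ofPair_one_apply]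
      have hδ : cross a b * cross a b = 1 := by rcases hab with h | h <;> rw [h] <;> norm_num
      have hδ' : (cross a b : ℝ) * cross a b = 1 := by exact_mod_cast hδ
      -- Cramer's rule; the determinant is a sign, so it is its own inverse and the preimage is
      -- integral.
      let x : ℤ × ℤ := (cross a b * (b.1 * (i - c) - a.1 * (j - e)),
        cross a b * (b.2 * (i - c) - a.2 * (j - e)))
      have hab' : (cross a b : ℝ) = a.1 * b.2 - a.2 * b.1 := by simp [cross]
      have hxy : ofPair x = y := by
        ext k
        simp only [realCross] at e1 e2
        fin_cases k
        · simp only [Fin.zero_eta, ofPair_zero_apply, x]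
          push_cast
          linear_combination (y 0) * hδ' - (cross a b : ℝ) * b.1 * e1 +
            (cross a b : ℝ) * a.1 * e2 - (cross a b : ℝ) * y 0 * hab'
        · simp only [Fin.mk_one, ofPair_one_apply, x]
          push_cast
          linear_combination (y 1) * hδ' - (cross a b : ℝ) * b.2 * e1 +
            (cross a b : ℝ) * a.2 * e2 - (cross a b : ℝ) * y 1 * hab'
      rw [← hxy, realCross_ofPair] at e1 e2
      refine ⟨x, ?_, by exact_mod_cast e1, by exact_mod_cast e2⟩
      rw [← hxy] at hy
      exact hy
    refine ⟨a, b, c, e, hab, fun x hx => ?_, hlat 0 0 le_rfl le_rfl (by omega),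
      hlat d 0 (by omega) le_rfl (by omega), hlat 0 d le_rfl (by omega) (by omega)⟩
    have hmem : φ (ofPair x) ∈ (d : ℝ) • stdTriangle := him ▸ ⟨_, hx, rfl⟩
    rw [mem_smul_stdTriangle hd, (h _).1, (h _).2, realCross_ofPair, realCross_ofPair] at hmem
    exact_mod_cast hmem
  · rintro ⟨a, b, c, e, hab, hS, ⟨x, hx, hx1, hx2⟩, ⟨y, hy, hy1, hy2⟩, ⟨z, hz, hz1, hz2⟩⟩
    refine ⟨_, isZAffine_of_coord c e hab, subset_antisymm ?_ ?_⟩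
    · rintro _ ⟨t, ht, rfl⟩
      rw [heq] at ht
      have h1 := le_realCross_of_mem_convexHull (f := a) (n := -c)
        (fun s hs => by linarith [(hS s hs).1]) ht
      have h2 := le_realCross_of_mem_convexHull (f := b) (n := -e)
        (fun s hs => by linarith [(hS s hs).2.1]) ht
      have h3 := realCross_le_of_mem_convexHull (f := a + b) (n := d - c - e)
        (fun s hs => by rw [cross_add_left]; linarith [(hS s hs).2.2]) ht
      have h4 : realCross (a + b) t = realCross a t + realCross b t := by
        simp only [realCross, Prod.fst_add, Prod.snd_add]; push_cast; ring
      rw [mem_smul_stdTriangle hd]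
      simp only [Matrix.cons_val_zero, Matrix.cons_val_one]
      push_cast at h1 h2 h3
      refine ⟨?_, ?_, ?_⟩ <;> linarith
    · have hconv : Convex ℝ Δ := by rw [heq]; exact convex_convexHull ℝ _
      rw [stdTriangle, ← convexHull_smul]
      refine convexHull_min ?_ ?_
      · rintro _ ⟨v, hv, rfl⟩
        have hpt : ∀ t ∈ pairs Δ, (d : ℝ) • v = ![((cross a t + c : ℤ) : ℝ),
            ((cross b t + e : ℤ) : ℝ)] →
            (d : ℝ) • v ∈ (fun x => ![realCross a x + c, realCross b x + e]) '' Δ := by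
          intro t ht hv
          refine ⟨ofPair t, ht, ?_⟩
          rw [hv]
          simp only [realCross_ofPair]
          push_cast
          rfl
        rcases hv with rfl | rfl | rfl
        · refine hpt x hx ?_
          rw [hx1, hx2]; simp
        · refine hpt y hy ?_
          rw [hy1, hy2]; simp
        · refine hpt z hz ?_
          rw [hz1, hz2]; simp
      · rintro _ ⟨s, hs, rfl⟩ _ ⟨t, ht, rfl⟩ α β hα hβ hαβ
        refine ⟨α • s + β • t, hconv hs ht hα hβ hαβ, ?_⟩
        ext i
        fin_cases i
        · simp [realCross]
          linear_combination (-(c : ℝ)) * hαβ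
        · simp [realCross]
          linear_combination (-(e : ℝ)) * hαβ

end LatticePolygon

/-! ### The main theorem -/

theorem theorem4 (Δ : Set (Fin 2 → ℝ)) (hΔ : LatticePolygon.IsLatticePolygon Δ)
    (hdim : LatticePolygon.dim Δ = 2) :
    ((¬ ∃ d : ℕ, 2 ≤ d ∧
        LatticePolygon.Equivalent Δ ((d : ℝ) • LatticePolygon.stdTriangle)) →
      LatticePolygon.lw Δ = LatticePolygon.lw (LatticePolygon.interiorHull Δ) + 2) ∧
    (∀ d : ℕ, 2 ≤ d →
      LatticePolygon.Equivalent Δ ((d : ℝ) • LatticePolygon.stdTriangle) →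
      LatticePolygon.lw Δ = LatticePolygon.lw (LatticePolygon.interiorHull Δ) + 3 ∧
        LatticePolygon.lw (LatticePolygon.interiorHull Δ) + 3 = (d : ℤ)) := by
  open LatticePolygon in
  have heq := hΔ.eq_convexHull
  have hconv : Convex ℝ Δ := by rw [heq]; exact convex_convexHull ℝ _
  have hint := interior_nonempty_of_dim hconv hdim
  have hfin := finite_pairs hΔ.isBounded
  have hseg := segmentClosed_pairs hconv
  have hS := not_width_zero hΔ hint
  have hSne := nonempty_of_not_width hS
  have hInner : {z | Inner (pairs Δ) z} = pairs (interior Δ) := by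
    ext z
    exact inner_iff_mem_interior hΔ hint z
  have hG : {z | Inner (pairs Δ) z}.Finite := by
    rw [hInner]
    exact finite_pairs (hΔ.isBounded.subset interior_subset)
  have hhull : interiorHull Δ = convexHull ℝ (ofPair '' {z | Inner (pairs Δ) z}) := by
    rw [hInner, image_ofPair_pairs, interiorHull]
  have hequiv : ∀ d : ℕ, 2 ≤ d →
      (Equivalent Δ ((d : ℝ) • stdTriangle) ↔ Triangle (pairs Δ) d) :=
    fun d hd => equivalent_smul_stdTriangle_iff hΔ (by omega)
  obtain ⟨n, hn, hnw, hnmin⟩ := exists_lw_eq hfin hSne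
  rw [← heq] at hn
  have hle : ∀ m : ℤ, Width (pairs Δ) m → n ≤ m := by
    intro m hm
    by_contra! hlt
    exact hnmin (hm.mono (by omega))
  rcases Set.eq_empty_or_nonempty {z | Inner (pairs Δ) z} with hempty | hne
  -- With the value -1 for the empty set, the two alternatives are width 1 and a standard triangle
  -- with `d = 2`.
  · have hlw : lw (interiorHull Δ) = -1 := by
      rw [hhull, hempty, Set.image_empty, convexHull_empty, lw, if_pos rfl]
    have hn1 : 1 ≤ n := by
      by_contra! h
      have : n = 0 := by omega
      subst this
      exact hS hnw
    have hno : ∀ z, ¬ Inner (pairs Δ) z := fun z hz => by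
      have : z ∈ {z | Inner (pairs Δ) z} := hz
      rw [hempty] at this
      exact this
    have hor := width_or_triangle_of_no_inner hfin hseg hS hno
    rw [hn, hlw]
    constructor
    · intro hnot
      rcases hor with h | h
      · have := hle 1 h
        omega
      · exact absurd ⟨2, le_rfl, (hequiv 2 le_rfl).2 h⟩ hnot
    · intro d hd hE
      have hT := (hequiv d hd).1 hE
      have h1 := hT.le_of_width (by omega) hnw
      have h2 := hle d hT.width
      rcases hor with h | h
      · have := hle 1 h
        omega
      · have := hle 2 h.width
        omega
  · obtain ⟨s, hs, hsw, hsmin⟩ := exists_lw_eq hG hne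
    rw [← hhull] at hs
    have hns : (s : ℤ) ≤ n - 2 := by
      by_contra! hlt
      exact hsmin (hnw.inner.mono (by omega))
    have hor := width_or_triangle_of_inner hfin hseg hS hG hne hsw hsmin
    rw [hn, hs]
    constructor
    · intro hnot
      rcases hor with h | h
      · have := hle _ h
        omega
      · exact absurd ⟨s + 3, by omega, (hequiv (s + 3) (by omega)).2 (by exact_mod_cast h)⟩ hnot
    · intro d hd hE
      have hT := (hequiv d hd).1 hE
      have h1 := hT.le_of_width (by omega) hnw
      have h2 := hle d hT.width
      have h3 : (s : ℤ) ≤ d - 3 := by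
        by_contra! hlt
        exact hsmin (hT.inner_width.mono (by omega))
      rcases hor with h | h
      · have := hle _ h
        omega
      · have := hle _ h.width
        omega
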